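/- **Notation.** For $z,w\in\mathbb C^n$ write $z\cdot w=\sum_j z_jw_j$, $|z|^2=\sum_j|z_j|^2$, $z^\alpha=\prod_j z_j^{\alpha_j}$. Let $\nu_{2n}$, $\nu_n$ be Lebesgue measure on $\mathbb C^n$, $\mathbb R^n$. The Fock space $\mathcal F^2(\mathbb C^n)$ consists of the entire functions in $L_2(\mathbb C^n,d\gamma_n)$, $d\gamma_n=\pi^{-n}e^{-|z|^2}d\nu_{2n}$; its reproducing kernel is $K_z(w)=e^{\bar z\cdot w}$. For $h\in\mathbb C^n$ the Weyl operator is $W_hf(z)=e^{z\cdot\bar h-|h|^2/2}f(z-h)$. A bounded operator $S$ on $\mathcal F^2(\mathbb C^n)$ is *horizontal* if $W_{ih}S=SW_{ih}$ for all $h\in\mathbb R^n$; its Berezin transform is $\widetilde S(z)=\langle SK_z,K_z\rangle/\langle K_z,K_z\rangle$. Let $k\in(\mathbb Z_+/2)^n$. A positive regular Borel measure $\mu$ on $\mathbb C^n$ (finite on compact sets) is a *$k$-FC measure* if $\sup_{z}\mu_k(B(z))<\infty$, where $d\mu_k(x+iy)=\prod_j(1+x_j^2)^{k_j}(1+y_j^2)^{k_j}\,d\mu(x+iy)$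 and $B(z)$ is the polydisk of polyradius $(1,\dots,1)$ centred at $z$, or if $k\in\mathbb Z_+^n$ and there is a constant $\omega$ with $\int|\partial^kf|^2e^{-|w|^2}d\mu\le\omega\int|f|^2e^{-|w|^2}d\nu_{2n}$ for all $f\in\mathcal F^2(\mathbb C^n)$. For $\alpha+\beta=2k$ put $$F_{\mu,\alpha,\beta}(f,g)=\pi^{-n}\int_{\mathbb C^n}\partial^\alpha f(z)\,\overline{\partial^\beta g(z)}\,e^{-|z|^2}d\mu(z),\qquad \widetilde{\partial^\alpha\bar\partial^\beta\mu}(z)=\pi^{-n}z^\beta\bar z^\alpha\int_{\mathbb C^n}e^{-|z-w|^2}d\mu(w),$$ and for the real coderivative $\partial_R^{2k}\mu=(\partial+\bar\partial)^{2k}\mu$ put $$F_{\mu,2k}=\sum_{\beta\le2k}\binom{2k}{\beta}F_{\mu,2k-\beta,\beta},\qquad \widetilde{\partial_R^{2k}\mu}=\sum_{\beta\le2k}\binom{2k}{\beta}\widetilde{\partial^{2k-\beta}\bar\partial^{\beta}\mu}.$$ **Theorem.** Let $k\in(\mathbb Z_+/2)^n$ and let $\mu$ be a positive $k$-FC measure.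 The integrals above converge for all $f,g\in\mathcal F^2(\mathbb C^n)$, $z\in\mathbb C^n$ and $\alpha+\beta=2k$; there is a unique bounded operator $T=T_{\partial_R^{2k}\mu}$ on $\mathcal F^2(\mathbb C^n)$ with $\langle Tf,g\rangle=F_{\mu,2k}(f,g)$ for all $f,g$; and $\widetilde T=\widetilde{\partial_R^{2k}\mu}$. Moreover, the following conditions are equivalent: 1. $T_{\partial_R^{2k}\mu}$ is horizontal. 2. $\widetilde{\partial_R^{2k}\mu}(z)$ depends only on $\operatorname{Re}z$. 3. $\mu(X+ih)=\mu(X)$ for every Borel set $X\subset\mathbb C^n$ and every $h\in\mathbb R^n$. 4. $\mu(Y\times(Z+h))=\mu(Y\times Z)$ for all Borel sets $Y,Z\subset\mathbb R^n$ and every $h\in\mathbb R^n$ (with $\mathbb C^n\simeq\mathbb R^n\times\mathbb R^n$, $x+iy\leftrightarrow(x,y)$). 5. $\mu=\varrho\otimes\nu_n$ for some regular Borel measure $\varrho$ on $\mathbb R^n$. -/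

import Mathlib

open MeasureTheory Complex
open scoped ENNReal NNReal ComplexConjugate

noncomputable section

namespace FockToeplitz

/-! ### Notation on `ℂⁿ = Fin n → ℂ` -/

variable {n : ℕ}

/-- `|z|² = ∑ⱼ |zⱼ|²`. -/
def normSqC (z : Fin n → ℂ) : ℝ := ∑ j, ‖z j‖ ^ 2

/-- `z · w = ∑ⱼ zⱼ wⱼ` (bilinear). -/
def dotC (z w : Fin n → ℂ) : ℂ := ∑ j, z j * w j

/-- The coordinatewise conjugate. -/
def conjC (z : Fin n → ℂ) : Fin n → ℂ := fun j => conj (z j)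

/-- The vector of real parts. -/
def reC (z : Fin n → ℂ) : Fin n → ℝ := fun j => (z j).re

/-- The purely imaginary vector `ih`, for `h ∈ ℝⁿ`. -/
def imagVec (h : Fin n → ℝ) : Fin n → ℂ := fun j => I * (h j : ℂ)

/-- The identification `ℝⁿ × ℝⁿ → ℂⁿ`, `(x, y) ↦ x + iy`. -/
def ofReIm (p : (Fin n → ℝ) × (Fin n → ℝ)) : Fin n → ℂ :=
  fun j => (p.1 j : ℂ) + I * (p.2 j : ℂ)

/-- The monomial `z^α`. -/
def mpow (z : Fin n → ℂ) (α : Fin n → ℕ) : ℂ := ∏ j, z j ^ α j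

/-- The multi-index binomial coefficient. -/
def mchoose (m β : Fin n → ℕ) : ℕ := ∏ j, (m j).choose (β j)

/-- The complex partial derivative in the `j`-th variable (it is the Wirtinger derivative
`∂/∂zⱼ` on entire functions). -/
def pderivC (j : Fin n) (f : (Fin n → ℂ) → ℂ) : (Fin n → ℂ) → ℂ :=
  fun z => fderiv ℂ f z (Pi.single j 1)

/-- `∂^α f = ∂₁^{α₁} ⋯ ∂ₙ^{αₙ} f`. -/
def mderiv (α : Fin n → ℕ) (f : (Fin n → ℂ) → ℂ) : (Fin n → ℂ) → ℂ :=
  (List.finRange n).foldr (fun j g => (pderivC j)^[α j] g) f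

/-! ### The Fock space -/

/-- The Gaussian probability measure `π⁻ⁿ exp(-|z|²) dν₂ₙ(z)` on `ℂⁿ`. -/
def gaussC (n : ℕ) : Measure (Fin n → ℂ) :=
  (volume : Measure (Fin n → ℂ)).withDensity
    (fun z => ENNReal.ofReal ((Real.pi ^ n)⁻¹ * Real.exp (-normSqC z)))

/-- The entire functions on `ℂⁿ` that are square integrable for the Gaussian measure. -/
def fockSubmodule (n : ℕ) : Submodule ℂ ((Fin n → ℂ) → ℂ) where
  carrier := {f | Differentiable ℂ f ∧ MemLp f 2 (gaussC n)}
  zero_mem' := ⟨differentiable_const 0, MemLp.zero⟩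
  add_mem' hf hg := ⟨hf.1.add hg.1, hf.2.add hg.2⟩
  smul_mem' c _ hf := ⟨hf.1.const_smul c, hf.2.const_smul c⟩

/-- The Fock (Segal--Bargmann) space. -/
def Fock (n : ℕ) : Type := fockSubmodule n

namespace Fock

instance : AddCommGroup (Fock n) := inferInstanceAs (AddCommGroup (fockSubmodule n))

instance : Module ℂ (Fock n) := inferInstanceAs (Module ℂ (fockSubmodule n))

instance : CoeFun (Fock n) (fun _ => (Fin n → ℂ) → ℂ) := ⟨fun f => f.1⟩

theorem ext {f g : Fock n} (h : ∀ z, f z = g z) : f = g := Subtype.ext (funext h)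

theorem add_apply (f g : Fock n) (z : Fin n → ℂ) : (f + g) z = f z + g z := rfl

theorem smul_apply (c : ℂ) (f : Fock n) (z : Fin n → ℂ) : (c • f) z = c * f z := rfl

theorem zero_apply (z : Fin n → ℂ) : (0 : Fock n) z = 0 := rfl

theorem differentiable (f : Fock n) : Differentiable ℂ f := f.2.1

theorem memLp (f : Fock n) : MemLp f 2 (gaussC n) := f.2.2

end Fock

theorem continuous_normSqC : Continuous (normSqC : (Fin n → ℂ) → ℝ) := by
  unfold normSqC; fun_prop

theorem measurable_gaussDensity : Measurable (fun z : Fin n → ℂ =>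
    ENNReal.ofReal ((Real.pi ^ n)⁻¹ * Real.exp (-normSqC z))) := by
  have := (continuous_normSqC (n := n)).measurable
  fun_prop

theorem volume_absolutelyContinuous_gaussC :
    (volume : Measure (Fin n → ℂ)) ≪ gaussC n := by
  refine withDensity_absolutelyContinuous' measurable_gaussDensity.aemeasurable ?_
  refine Filter.Eventually.of_forall fun z => ?_
  have : 0 < (Real.pi ^ n)⁻¹ * Real.exp (-normSqC z) := by positivity
  simpa using this

theorem Fock.integrable_inner (f g : Fock n) :
    Integrable (fun z => conj (f z) * g z) (gaussC n) :=
  f.memLp.star.integrable_mul g.memLp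

/-- The inner product `∫ conj(f) g dγₙ` (linear in the second variable, as in Mathlib). -/
@[reducible] def fockCore (n : ℕ) : InnerProductSpace.Core ℂ (Fock n) where
  inner f g := ∫ z, conj (f z) * g z ∂(gaussC n)
  conj_inner_symm f g := by
    rw [← integral_conj]
    congr 1; ext z; simp [mul_comm]
  re_inner_nonneg f := by
    have h : ∀ z, conj (f z) * f z = ((‖f z‖ ^ 2 : ℝ) : ℂ) := fun z => by
      rw [Complex.conj_mul']; norm_cast
    simp only [h]
    rw [integral_complex_ofReal]
    simpa using integral_nonneg (fun z => by positivity)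
  add_left f g h := by
    rw [← integral_add (f.integrable_inner h) (g.integrable_inner h)]
    congr 1; ext z; simp only [Fock.add_apply, map_add]; ring
  smul_left f g c := by
    rw [← integral_const_mul]
    congr 1; ext z; simp only [Fock.smul_apply, map_mul]; ring
  definite f hf := by
    have h : ∀ z, conj (f z) * f z = ((‖f z‖ ^ 2 : ℝ) : ℂ) := fun z => by
      rw [Complex.conj_mul']; norm_cast
    simp only [h] at hf
    rw [integral_complex_ofReal] at hf
    have hi : Integrable (fun z => ‖f z‖ ^ 2) (gaussC n) := f.memLp.integrable_norm_pow (by simp)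
    have h0 := (integral_eq_zero_iff_of_nonneg (fun z => by positivity) hi).1 (by exact_mod_cast hf)
    have h1 := volume_absolutelyContinuous_gaussC.ae_le h0
    have h2 : (fun z => ‖f z‖ ^ 2) = 0 :=
      Continuous.ae_eq_iff_eq (volume : Measure (Fin n → ℂ))
        (f.differentiable.continuous.norm.pow 2) continuous_zero |>.1 h1
    refine Fock.ext fun z => ?_
    have := congrFun h2 z
    simpa [Fock.zero_apply] using this

instance : NormedAddCommGroup (Fock n) := (fockCore n).toNormedAddCommGroup

instance : InnerProductSpace ℂ (Fock n) := InnerProductSpace.ofCore (fockCore n).toCore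

/-! ### Reproducing kernels and Weyl operators -/

theorem memLp_gaussC_iff {f : (Fin n → ℂ) → ℂ} (hf : Continuous f) :
    MemLp f 2 (gaussC n) ↔ Integrable (fun z => ‖f z‖ ^ 2 * Real.exp (-normSqC z)) := by
  have hpi : (Real.pi ^ n)⁻¹ ≠ 0 := by positivity
  rw [memLp_two_iff_integrable_sq_norm hf.aestronglyMeasurable, gaussC,
    integrable_withDensity_iff measurable_gaussDensity (Filter.Eventually.of_forall fun z => by simp)]
  have : (fun z => ‖f z‖ ^ 2 * (ENNReal.ofReal ((Real.pi ^ n)⁻¹ * Real.exp (-normSqC z))).toReal)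
      = fun z => (Real.pi ^ n)⁻¹ * (‖f z‖ ^ 2 * Real.exp (-normSqC z)) := by
    ext z
    rw [ENNReal.toReal_ofReal (by positivity)]; ring
  rw [this, integrable_const_mul_iff hpi.isUnit]

theorem integrable_exp_neg_normSqC :
    Integrable (fun z : Fin n → ℂ => Real.exp (-normSqC z)) := by
  have h1 : Integrable (fun w : ℂ => Real.exp (-‖w‖ ^ 2)) := by
    have := (GaussianFourier.integrable_cexp_neg_mul_sq_norm_add (V := ℂ) (b := 1)
      (by simp) 0 0).norm
    simpa [Complex.norm_exp, ← Complex.ofReal_pow, -Complex.ofReal_neg] using this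
  have := Integrable.fintype_prod_dep (ι := Fin n) (E := fun _ => ℂ) (𝕜 := ℝ)
    (f := fun _ w => Real.exp (-‖w‖ ^ 2)) (μ := fun _ => volume) (fun _ => h1)
  rw [← volume_pi] at this
  refine this.congr (Filter.Eventually.of_forall fun z => ?_)
  simp only [normSqC, ← Real.exp_sum, Finset.sum_neg_distrib]

theorem normSqC_sub (z h : Fin n → ℂ) :
    normSqC (z - h) = normSqC z - 2 * (dotC z (conjC h)).re + normSqC h := by
  simp only [normSqC, dotC, conjC, Complex.re_sum, Finset.mul_sum, ← Finset.sum_sub_distrib,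
    ← Finset.sum_add_distrib]
  refine Finset.sum_congr rfl fun j _ => ?_
  simp only [← Complex.normSq_eq_norm_sq, Pi.sub_apply, Complex.normSq_sub]
  ring

/-- The weighted translation `(W_h f)(z) = exp(z · conj(h) - |h|²/2) f(z - h)`. -/
def weylFun (h : Fin n → ℂ) (f : (Fin n → ℂ) → ℂ) : (Fin n → ℂ) → ℂ :=
  fun z => Complex.exp (dotC z (conjC h) - (normSqC h / 2 : ℝ)) * f (z - h)

theorem weylFun_mem (h : Fin n → ℂ) (f : Fock n) : weylFun h f ∈ fockSubmodule n := by
  have hd : Differentiable ℂ (weylFun h f) := by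
    have h1 : Differentiable ℂ (fun z : Fin n → ℂ => f (z - h)) :=
      f.differentiable.comp (differentiable_id.sub_const h)
    have h2 : Differentiable ℂ (fun z : Fin n → ℂ =>
        Complex.exp (dotC z (conjC h) - (normSqC h / 2 : ℝ))) := by
      unfold dotC; fun_prop
    exact h2.mul h1
  refine ⟨hd, (memLp_gaussC_iff hd.continuous).2 ?_⟩
  have h1 := (memLp_gaussC_iff f.differentiable.continuous).1 f.memLp
  refine (h1.comp_sub_right h).congr (Filter.Eventually.of_forall fun z => ?_)
  simp only [weylFun, norm_mul, mul_pow, Complex.norm_exp]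
  rw [normSqC_sub, ← Real.exp_nat_mul, mul_right_comm, ← Real.exp_add, mul_comm]
  congr 2
  simp
  ring

/-- The Weyl operator `W_h` on the Fock space. -/
def weyl (h : Fin n → ℂ) : Fock n →ₗ[ℂ] Fock n where
  toFun f := ⟨weylFun h f, weylFun_mem h f⟩
  map_add' f g := Fock.ext fun z => by
    change weylFun h (fun w => f w + g w) z = weylFun h f z + weylFun h g z
    simp only [weylFun]; ring
  map_smul' c f := Fock.ext fun z => by
    change weylFun h (fun w => c * f w) z = c * weylFun h f z
    simp only [weylFun]; ring

theorem kernel_mem (z : Fin n → ℂ) :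
    (fun w => Complex.exp (dotC (conjC z) w)) ∈ fockSubmodule n := by
  have hd : Differentiable ℂ (fun w : Fin n → ℂ => Complex.exp (dotC (conjC z) w)) := by
    unfold dotC; fun_prop
  refine ⟨hd, (memLp_gaussC_iff hd.continuous).2 ?_⟩
  have h1 := ((integrable_exp_neg_normSqC (n := n)).comp_sub_right z).const_mul
    (Real.exp (normSqC z))
  refine h1.congr (Filter.Eventually.of_forall fun w => ?_)
  simp only [Complex.norm_exp]
  rw [normSqC_sub, ← Real.exp_nat_mul, ← Real.exp_add, ← Real.exp_add]
  congr 1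
  have : dotC w (conjC z) = dotC (conjC z) w := by simp [dotC, mul_comm]
  rw [this]; push_cast; ring

/-- The reproducing kernel `K_z(w) = exp(conj(z) · w)`. -/
def kernel (z : Fin n → ℂ) : Fock n := ⟨fun w => Complex.exp (dotC (conjC z) w), kernel_mem z⟩

/-- A bounded operator on the Fock space is horizontal if it commutes with all `W_{ih}`,
`h ∈ ℝⁿ`. -/
def IsHorizontalOp (S : Fock n →L[ℂ] Fock n) : Prop :=
  ∀ (h : Fin n → ℝ) (f : Fock n), weyl (imagVec h) (S f) = S (weyl (imagVec h) f)

/-- The Berezin transform `⟨S K_z, K_z⟩ / ⟨K_z, K_z⟩` of a bounded operator `S`. -/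
def berezinOp (S : Fock n →L[ℂ] Fock n) (z : Fin n → ℂ) : ℂ :=
  inner ℂ (kernel z) (S (kernel z)) / inner ℂ (kernel z) (kernel z)

/-- The function `φ` on `ℂⁿ` depends only on `Re z`. -/
def DependsOnlyOnRe (φ : (Fin n → ℂ) → ℂ) : Prop :=
  ∃ b : (Fin n → ℝ) → ℂ, ∀ z, φ z = b (reC z)

/-! ### Fock--Carleson measures for derivatives, coderivatives -/

/-- `dμ_k = ∏ⱼ (1 + xⱼ²)^{kⱼ} (1 + yⱼ²)^{kⱼ} dμ`. -/
def weighted (μ : Measure (Fin n → ℂ)) (k : Fin n → ℝ) : Measure (Fin n → ℂ) :=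
  μ.withDensity (fun z => ENNReal.ofReal
    (∏ j, (1 + (z j).re ^ 2) ^ k j * (1 + (z j).im ^ 2) ^ k j))

/-- The Carleson inequality for derivatives of integral order `p`:
`∫ |∂^p f|² exp(-|w|²) dμ ≤ ω ∫ |f|² exp(-|w|²) dν₂ₙ` for all `f` in the Fock space. -/
def CarlesonIneq (p : Fin n → ℕ) (μ : Measure (Fin n → ℂ)) : Prop :=
  ∃ ω : ℝ≥0, ∀ f : Fock n,
    ∫⁻ w, ENNReal.ofReal (‖mderiv p f w‖ ^ 2 * Real.exp (-normSqC w)) ∂μ ≤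
      ω * ∫⁻ w, ENNReal.ofReal (‖f w‖ ^ 2 * Real.exp (-normSqC w))

/-- A positive measure is a `k`-FC measure, `k ∈ (ℤ₊/2)ⁿ`, if `k` is integral and the Carleson
inequality for derivatives of order `k` holds, or if the `μ_k`-mass of the polydisks of polyradius
`(1, …, 1)` is bounded. (`Metric.ball` in `Fin n → ℂ` is an open polydisk.) -/
def IsKFC (k : Fin n → ℝ) (μ : Measure (Fin n → ℂ)) : Prop :=
  (∃ p : Fin n → ℕ, (∀ j, k j = p j) ∧ CarlesonIneq p μ) ∨
    ∃ C : ℝ≥0, ∀ z : Fin n → ℂ, weighted μ k (Metric.ball z 1) ≤ C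

/-- The integrand `∂^α f(z) conj(∂^β g(z)) exp(-|z|²)`. -/
def formIntegrand (α β : Fin n → ℕ) (f g : Fock n) (z : Fin n → ℂ) : ℂ :=
  mderiv α f z * conj (mderiv β g z) * (Real.exp (-normSqC z) : ℂ)

/-- The sesquilinear form `π⁻ⁿ ∫ ∂^α f conj(∂^β g) exp(-|z|²) dμ` of the coderivative
`∂^α ∂̄^β μ`. -/
def coderivForm (μ : Measure (Fin n → ℂ)) (α β : Fin n → ℕ) (f g : Fock n) : ℂ :=
  ((Real.pi : ℂ) ^ n)⁻¹ * ∫ z, formIntegrand α β f g z ∂μ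

/-- The sesquilinear form of the real coderivative `(∂ + ∂̄)^m μ = ∑_{β ≤ m} (m choose β)
∂^{m-β} ∂̄^β μ`. -/
def realCoderivForm (μ : Measure (Fin n → ℂ)) (m : Fin n → ℕ) (f g : Fock n) : ℂ :=
  ∑ β ∈ Finset.Iic m, (mchoose m β : ℂ) * coderivForm μ (m - β) β f g

/-- `T` is the Toeplitz operator of the real coderivative `(∂ + ∂̄)^m μ`: the bounded operator
generated by its sesquilinear form. The inner product `⟨T f, g⟩`, linear in the first slot, is
`inner ℂ g (T f)`. -/
def IsRealCoderivToeplitz (μ : Measure (Fin n → ℂ)) (m : Fin n → ℕ)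
    (T : Fock n →L[ℂ] Fock n) : Prop :=
  ∀ f g : Fock n, inner ℂ g (T f) = realCoderivForm μ m f g

/-- The Berezin transform `π⁻ⁿ z^β conj(z)^α ∫ exp(-|z-w|²) dμ(w)` of `∂^α ∂̄^β μ`. -/
def berezinCoderiv (μ : Measure (Fin n → ℂ)) (α β : Fin n → ℕ) (z : Fin n → ℂ) : ℂ :=
  ((Real.pi : ℂ) ^ n)⁻¹ * mpow z β * mpow (conjC z) α *
    ((∫ w, Real.exp (-normSqC (z - w)) ∂μ : ℝ) : ℂ)

/-- The Berezin transform of the real coderivative `(∂ + ∂̄)^m μ`. -/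
def berezinRealCoderiv (μ : Measure (Fin n → ℂ)) (m : Fin n → ℕ) (z : Fin n → ℂ) : ℂ :=
  ∑ β ∈ Finset.Iic m, (mchoose m β : ℂ) * berezinCoderiv μ (m - β) β z

/-- `μ = ϱ ⊗ νₙ` for some regular Borel measure `ϱ` on `ℝⁿ`, `νₙ` being Lebesgue measure, under
the identification `(x, y) ↦ x + iy`. -/
def IsHorizontalMeasure (μ : Measure (Fin n → ℂ)) : Prop :=
  ∃ ϱ : Measure (Fin n → ℝ), ϱ.Regular ∧
    μ = (ϱ.prod (volume : Measure (Fin n → ℝ))).map ofReIm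

end FockToeplitz

end

open FockToeplitz

/-!
The analytic input is a single estimate. Both alternatives in the definition of a `k`-FC measure say
that `∏ⱼ (1 + |zⱼ|)^{2kⱼ} dμ` has bounded mass on unit polydisks (`IsKFC.ballBounded`; the Carleson
inequality is tested on reproducing kernels), so that its Gaussian averages are bounded. Every
element of the Fock space is its own Bargmann integral (`Fock.bargmann_eq`), whence
`∂^α f(z) exp(-|z|²/2)` is bounded by `∏ⱼ (1 + |zⱼ|)^{αⱼ}` times the root of a Gaussian average of
`|f|²` about `z`. As `α + β = 2k`, the Cauchy--Schwarz inequality makes every form `F_{μ,α,β}`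
absolutely convergent and bounded (`exists_lintegral_formIntegrand_le`). The Fock space is complete,
because an `L²`-limit of its elements agrees with its own Bargmann integral, so the Riesz theorem
gives the operator.

On reproducing kernels the multi-index binomial theorem collapses the real coderivative to
`F(K_a, K_b) = (conj(a) + b)^{2k} π⁻ⁿ ∫ exp(conj(a) · w + b · conj(w) - |w|²) dμ(w)`
(`realCoderivForm_kernel`). For `a = b = z` this is the formula for the Berezin transform, with
factor `(2 Re z)^{2k}`.

* If `T` is horizontal, then its Berezin transform depends only on `Re z`, since `W_{ih}` is an
  isometry carrying `K_z` to a multiple of `K_{z+ih}`.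
* If the Berezin transform depends only on `Re z`, divide by `(2 Re z)^{2k}` off its zeros and
  extend by continuity: the Gaussian transform `∫ exp(-|z - w|²) dμ(w)` depends only on `Re z`, so `μ` and
  its translates by `ih` have the same Gaussian transform. This is a Laplace transform in disguise
  and determines the measure (`eq_of_heatTransform_eq`).
* Invariance on rectangles makes the slices of `μ` multiples of Lebesgue measure
  (`exists_eq_prod_volume`), and a product with Lebesgue measure is invariant.
* If `μ` is invariant, the factor `(conj(a) + b)^{2k}` and the scaled integral above are both unchanged
  when `W_{ih}` acts on both kernels, so `T` commutes with `W_{ih}` on kernels, which span a dense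
  subspace.
-/

noncomputable section

namespace FockToeplitz

variable {n : ℕ}

/-! ### Gaussian integrals on `ℂⁿ` -/

/-- The `ℓ¹`-norm `∑ⱼ |zⱼ|`, which dominates the linear exponents that occur below. -/
def normOneC (z : Fin n → ℂ) : ℝ := ∑ j, ‖z j‖

theorem continuous_normOneC : Continuous (normOneC : (Fin n → ℂ) → ℝ) := by
  unfold normOneC; fun_prop

theorem normOneC_nonneg (z : Fin n → ℂ) : 0 ≤ normOneC z :=
  Finset.sum_nonneg fun _ _ => norm_nonneg _

theorem norm_le_normOneC (z : Fin n → ℂ) (j : Fin n) : ‖z j‖ ≤ normOneC z :=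
  Finset.single_le_sum (f := fun j => ‖z j‖) (fun _ _ => norm_nonneg _) (Finset.mem_univ j)

theorem integrable_exp_neg_mul_normSqC {c : ℝ} (hc : 0 < c) :
    Integrable (fun z : Fin n → ℂ => Real.exp (-c * normSqC z)) := by
  have h1 : Integrable (fun w : ℂ => Real.exp (-c * ‖w‖ ^ 2)) := by
    have := (GaussianFourier.integrable_cexp_neg_mul_sq_norm_add (V := ℂ) (b := (c : ℂ))
      (by simpa using hc) 0 0).norm
    simpa [Complex.norm_exp, ← Complex.ofReal_pow, -Complex.ofReal_neg] using this
  have := Integrable.fintype_prod_dep (ι := Fin n) (E := fun _ => ℂ) (𝕜 := ℝ)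
    (f := fun _ w => Real.exp (-c * ‖w‖ ^ 2)) (μ := fun _ => volume) (fun _ => h1)
  rw [← volume_pi] at this
  refine this.congr (Filter.Eventually.of_forall fun z => ?_)
  simp only [normSqC, ← Real.exp_sum, Finset.mul_sum]

theorem mul_normOneC_le {c : ℝ} (hc : 0 < c) (R : ℝ) (z : Fin n → ℂ) :
    R * normOneC z ≤ n * (R ^ 2 / (4 * c)) + c * normSqC z := by
  have h : ∀ t : ℝ, R * t ≤ R ^ 2 / (4 * c) + c * t ^ 2 := fun t => by
    have h2 : R ^ 2 / (4 * c) + c * t ^ 2 - R * t = (R - 2 * c * t) ^ 2 / (4 * c) := by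
      field_simp; ring
    have : 0 ≤ (R - 2 * c * t) ^ 2 / (4 * c) := by positivity
    linarith
  calc R * normOneC z = ∑ j, R * ‖z j‖ := by simp [normOneC, Finset.mul_sum]
    _ ≤ ∑ j, (R ^ 2 / (4 * c) + c * ‖z j‖ ^ 2) := Finset.sum_le_sum fun j _ => h _
    _ = _ := by simp [Finset.sum_add_distrib, normSqC, Finset.mul_sum]

theorem integrable_exp_normOneC_sub {c : ℝ} (hc : 0 < c) (R : ℝ) :
    Integrable (fun z : Fin n → ℂ => Real.exp (R * normOneC z - c * normSqC z)) := by
  have hcont : Continuous (fun z : Fin n → ℂ => Real.exp (R * normOneC z - c * normSqC z)) := by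
    have := continuous_normOneC (n := n)
    have := continuous_normSqC (n := n)
    fun_prop
  refine ((integrable_exp_neg_mul_normSqC (n := n) (half_pos hc)).const_mul
    (Real.exp (n * (R ^ 2 / (4 * (c / 2)))))).mono' hcont.aestronglyMeasurable
    (Filter.Eventually.of_forall fun z => ?_)
  rw [Real.norm_eq_abs, Real.abs_exp, ← Real.exp_add, Real.exp_le_exp]
  have := mul_normOneC_le (half_pos hc) R z
  linarith

theorem integral_exp_neg_normSqC :
    ∫ z : Fin n → ℂ, Real.exp (-normSqC z) = Real.pi ^ n := by
  have h1 : ∫ w : ℂ, Real.exp (-‖w‖ ^ 2) = Real.pi := by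
    have := GaussianFourier.integral_rexp_neg_mul_sq_norm (V := ℂ) (b := 1) one_pos
    simpa using this
  have h2 : ∀ z : Fin n → ℂ, Real.exp (-normSqC z) = ∏ j, Real.exp (-‖z j‖ ^ 2) := fun z => by
    simp [normSqC, ← Real.exp_sum]
  simp_rw [h2]
  rw [integral_fintype_prod_volume_eq_prod (fun _ : Fin n => fun w : ℂ => Real.exp (-‖w‖ ^ 2))]
  simp [h1]

theorem integral_gaussC (f : (Fin n → ℂ) → ℂ) :
    ∫ z, f z ∂(gaussC n) =
      ((Real.pi : ℂ) ^ n)⁻¹ * ∫ z, f z * (Real.exp (-normSqC z) : ℂ) := by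
  rw [gaussC, integral_withDensity_eq_integral_toReal_smul measurable_gaussDensity
    (Filter.Eventually.of_forall fun z => by simp), ← integral_const_mul]
  congr 1; ext z
  rw [ENNReal.toReal_ofReal (by positivity), Complex.real_smul]
  push_cast; ring

instance isProbabilityMeasure_gaussC : IsProbabilityMeasure (gaussC n) := by
  refine ⟨?_⟩
  rw [gaussC, withDensity_apply _ MeasurableSet.univ, Measure.restrict_univ,
    ← ofReal_integral_eq_lintegral_ofReal ((integrable_exp_neg_normSqC).const_mul _)
      (Filter.Eventually.of_forall fun z => by positivity), integral_const_mul,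
    integral_exp_neg_normSqC, inv_mul_cancel₀ (by positivity), ENNReal.ofReal_one]

theorem lintegral_gaussC {f : (Fin n → ℂ) → ℝ≥0∞} (hf : Measurable f) :
    ∫⁻ z, f z ∂(gaussC n) =
      ∫⁻ z, ENNReal.ofReal ((Real.pi ^ n)⁻¹ * Real.exp (-normSqC z)) * f z := by
  rw [gaussC, lintegral_withDensity_eq_lintegral_mul _ measurable_gaussDensity hf]
  rfl

theorem memLp_exp_normOneC (R : ℝ) :
    MemLp (fun z : Fin n → ℂ => (Real.exp (R * normOneC z) : ℂ)) 2 (gaussC n) := by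
  have hcont : Continuous (fun z : Fin n → ℂ => (Real.exp (R * normOneC z) : ℂ)) := by
    have := continuous_normOneC (n := n)
    fun_prop
  rw [memLp_gaussC_iff hcont]
  refine (integrable_exp_normOneC_sub (n := n) one_pos (2 * R)).congr
    (Filter.Eventually.of_forall fun z => ?_)
  simp only [Complex.norm_real, Real.norm_eq_abs, Real.abs_exp, ← Real.exp_nat_mul, ← Real.exp_add]
  congr 1; push_cast; ring

/-! ### The Bargmann integral -/

/-- Functions that stay integrable for the Gaussian measure after multiplication by any
exponential `exp(R ∑ⱼ |wⱼ|)`. -/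
def ExpIntegrable (G : (Fin n → ℂ) → ℂ) : Prop :=
  ∀ R : ℝ, Integrable (fun w => (Real.exp (R * normOneC w) : ℂ) * G w) (gaussC n)

/-- The Bargmann integral `z ↦ ∫ exp(z · conj(w)) G(w) dγₙ(w)`: the orthogonal projection onto the
Fock space when `G ∈ L²(γₙ)`. -/
def bargmann (G : (Fin n → ℂ) → ℂ) (z : Fin n → ℂ) : ℂ :=
  ∫ w, Complex.exp (dotC z (conjC w)) * G w ∂(gaussC n)

theorem ExpIntegrable.of_memLp {G : (Fin n → ℂ) → ℂ} (hG : MemLp G 2 (gaussC n)) :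
    ExpIntegrable G := fun R => (memLp_exp_normOneC R).integrable_mul hG

theorem ExpIntegrable.aestronglyMeasurable {G : (Fin n → ℂ) → ℂ} (hG : ExpIntegrable G) :
    AEStronglyMeasurable G (gaussC n) := by
  simpa using (hG 0).aestronglyMeasurable

theorem ExpIntegrable.mono {G H : (Fin n → ℂ) → ℂ} (hG : ExpIntegrable G)
    (hH : AEStronglyMeasurable H (gaussC n)) (R : ℝ)
    (h : ∀ w, ‖H w‖ ≤ Real.exp (R * normOneC w) * ‖G w‖) : ExpIntegrable H := fun S => by
  refine (hG (S + R)).mono (AEStronglyMeasurable.mul ?_ hH)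
    (Filter.Eventually.of_forall fun w => ?_)
  · have := continuous_normOneC (n := n)
    exact Continuous.aestronglyMeasurable (by fun_prop)
  · simp only [norm_mul, Complex.norm_real, Real.norm_eq_abs, Real.abs_exp, add_mul, Real.exp_add,
      mul_assoc]
    gcongr
    exact h w

theorem continuous_dotC_conjC (z : Fin n → ℂ) : Continuous (fun w => dotC z (conjC w)) := by
  unfold dotC conjC; fun_prop

theorem norm_dotC_conjC_le (z w : Fin n → ℂ) : ‖dotC z (conjC w)‖ ≤ ‖z‖ * normOneC w := by
  unfold dotC normOneC
  refine (norm_sum_le _ _).trans ?_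
  rw [Finset.mul_sum]
  refine Finset.sum_le_sum fun j _ => ?_
  simp only [conjC, norm_mul, RCLike.norm_conj]
  gcongr
  exact norm_le_pi_norm z j

theorem norm_exp_dotC_conjC_le (z w : Fin n → ℂ) :
    ‖Complex.exp (dotC z (conjC w))‖ ≤ Real.exp (‖z‖ * normOneC w) := by
  rw [Complex.norm_exp, Real.exp_le_exp]
  exact (Complex.re_le_norm _).trans (norm_dotC_conjC_le z w)

theorem ExpIntegrable.integrable_exp_mul {G : (Fin n → ℂ) → ℂ} (hG : ExpIntegrable G)
    (z : Fin n → ℂ) : Integrable (fun w => Complex.exp (dotC z (conjC w)) * G w) (gaussC n) := by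
  refine (hG ‖z‖).mono ((continuous_dotC_conjC z).cexp.aestronglyMeasurable.mul
    hG.aestronglyMeasurable) (Filter.Eventually.of_forall fun w => ?_)
  simp only [norm_mul, Complex.norm_real, Real.norm_eq_abs, Real.abs_exp]
  gcongr
  exact norm_exp_dotC_conjC_le z w

/-- The linear form `v ↦ v · conj(w)`. -/
def dotConjCLM (w : Fin n → ℂ) : (Fin n → ℂ) →L[ℂ] ℂ :=
  ∑ j, conj (w j) • ContinuousLinearMap.proj j

theorem dotConjCLM_apply (w v : Fin n → ℂ) : dotConjCLM w v = dotC v (conjC w) := by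
  simp [dotConjCLM, dotC, conjC, mul_comm]

theorem norm_dotConjCLM_le (w : Fin n → ℂ) : ‖dotConjCLM w‖ ≤ normOneC w :=
  ContinuousLinearMap.opNorm_le_bound _ (normOneC_nonneg w) fun v => by
    rw [dotConjCLM_apply, mul_comm]; exact norm_dotC_conjC_le v w

theorem continuous_dotConjCLM : Continuous (dotConjCLM (n := n)) := by
  unfold dotConjCLM; fun_prop

theorem hasFDerivAt_exp_dotC_conjC (w z : Fin n → ℂ) :
    HasFDerivAt (fun z => Complex.exp (dotC z (conjC w)))
      (Complex.exp (dotC z (conjC w)) • dotConjCLM w) z := by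
  have := ((dotConjCLM w).hasFDerivAt (x := z)).cexp
  simpa only [dotConjCLM_apply] using this

/-- The Bargmann integral may be differentiated under the integral sign. -/
theorem ExpIntegrable.hasFDerivAt_bargmann {G : (Fin n → ℂ) → ℂ} (hG : ExpIntegrable G)
    (z : Fin n → ℂ) :
    Integrable (fun w => (Complex.exp (dotC z (conjC w)) * G w) • dotConjCLM w) (gaussC n) ∧
    HasFDerivAt (bargmann G)
      (∫ w, (Complex.exp (dotC z (conjC w)) * G w) • dotConjCLM w ∂(gaussC n)) z := by
  have hbound : ∀ x ∈ Metric.ball z 1, ∀ w,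
      ‖(Complex.exp (dotC x (conjC w)) * G w) • dotConjCLM w‖ ≤
        ‖(Real.exp ((‖z‖ + 2) * normOneC w) : ℂ) * G w‖ := fun x hx w => by
    have hxz : ‖x‖ ≤ ‖z‖ + 1 := by
      have := norm_sub_norm_le x z
      rw [mem_ball_iff_norm] at hx
      linarith
    have h1 : ‖Complex.exp (dotC x (conjC w))‖ ≤ Real.exp ((‖z‖ + 1) * normOneC w) :=
      (norm_exp_dotC_conjC_le x w).trans (Real.exp_le_exp.2
        (mul_le_mul_of_nonneg_right hxz (normOneC_nonneg w)))
    have h2 : ‖dotConjCLM w‖ ≤ Real.exp (normOneC w) :=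
      (norm_dotConjCLM_le w).trans (by linarith [Real.add_one_le_exp (normOneC w)])
    simp only [norm_smul, norm_mul, Complex.norm_real, Real.norm_eq_abs, Real.abs_exp]
    calc _ ≤ Real.exp ((‖z‖ + 1) * normOneC w) * ‖G w‖ * Real.exp (normOneC w) := by gcongr
      _ = _ := by
        rw [mul_right_comm, ← Real.exp_add]; ring_nf
  have hmeas : AEStronglyMeasurable
      (fun w => (Complex.exp (dotC z (conjC w)) * G w) • dotConjCLM w) (gaussC n) :=
    ((continuous_dotC_conjC z).cexp.aestronglyMeasurable.mul
      hG.aestronglyMeasurable).smul continuous_dotConjCLM.aestronglyMeasurable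
  refine ⟨(hG (‖z‖ + 2)).mono hmeas (Filter.Eventually.of_forall fun w =>
    hbound z (Metric.mem_ball_self one_pos) w), ?_⟩
  refine hasFDerivAt_integral_of_dominated_of_fderiv_le (Metric.ball_mem_nhds z one_pos)
    (F' := fun x w => (Complex.exp (dotC x (conjC w)) * G w) • dotConjCLM w)
    (Filter.Eventually.of_forall fun x => (hG.integrable_exp_mul x).aestronglyMeasurable)
    (hG.integrable_exp_mul z) hmeas (Filter.Eventually.of_forall fun w x hx => hbound x hx w)
    (hG (‖z‖ + 2)).norm (Filter.Eventually.of_forall fun w x _ => ?_)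
  have := (hasFDerivAt_exp_dotC_conjC w x).mul_const (G w)
  rwa [smul_smul, mul_comm (G w)] at this

theorem ExpIntegrable.differentiable_bargmann {G : (Fin n → ℂ) → ℂ} (hG : ExpIntegrable G) :
    Differentiable ℂ (bargmann G) := fun z => (hG.hasFDerivAt_bargmann z).2.differentiableAt

theorem ExpIntegrable.conj_mul {G : (Fin n → ℂ) → ℂ} (hG : ExpIntegrable G) (j : Fin n) :
    ExpIntegrable (fun w => conj (w j) * G w) := by
  refine hG.mono (AEStronglyMeasurable.mul (Continuous.aestronglyMeasurable (by fun_prop))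
    hG.aestronglyMeasurable) 1 fun w => ?_
  simp only [norm_mul, RCLike.norm_conj, one_mul]
  gcongr
  linarith [norm_le_normOneC w j, Real.add_one_le_exp (normOneC w)]

theorem ExpIntegrable.pderivC_bargmann {G : (Fin n → ℂ) → ℂ} (hG : ExpIntegrable G) (j : Fin n) :
    pderivC j (bargmann G) = bargmann (fun w => conj (w j) * G w) := by
  ext z
  obtain ⟨h1, h2⟩ := hG.hasFDerivAt_bargmann z
  rw [pderivC, h2.fderiv, ContinuousLinearMap.integral_apply h1, bargmann]
  congr 1; ext w
  have hj : dotConjCLM w (Pi.single j 1) = conj (w j) := by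
    simp [dotConjCLM, Pi.single_apply]
  rw [smul_apply, hj, smul_eq_mul]; ring

theorem ExpIntegrable.pderivC_iterate_bargmann {G : (Fin n → ℂ) → ℂ} (hG : ExpIntegrable G)
    (j : Fin n) (a : ℕ) :
    ExpIntegrable (fun w => conj (w j) ^ a * G w) ∧
      (pderivC j)^[a] (bargmann G) = bargmann (fun w => conj (w j) ^ a * G w) := by
  induction a with
  | zero => simpa using hG
  | succ a ih =>
    have e : (fun w : Fin n → ℂ => conj (w j) * (conj (w j) ^ a * G w)) =
        fun w => conj (w j) ^ (a + 1) * G w := by ext w; ring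
    refine ⟨e ▸ ih.1.conj_mul j, ?_⟩
    rw [Function.iterate_succ_apply', ih.2, ih.1.pderivC_bargmann, e]

/-- Differentiating the Bargmann integral of `G` multiplies `G` by the conjugate monomial. -/
theorem ExpIntegrable.mderiv_bargmann {G : (Fin n → ℂ) → ℂ} (hG : ExpIntegrable G)
    (α : Fin n → ℕ) :
    ExpIntegrable (fun w => mpow (conjC w) α * G w) ∧
      mderiv α (bargmann G) = bargmann (fun w => mpow (conjC w) α * G w) := by
  have key : ∀ l : List (Fin n),
      ExpIntegrable (fun w => (l.map fun j => conj (w j) ^ α j).prod * G w) ∧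
      l.foldr (fun j g => (pderivC j)^[α j] g) (bargmann G) =
        bargmann (fun w => (l.map fun j => conj (w j) ^ α j).prod * G w) := fun l => by
    induction l with
    | nil => simpa using hG
    | cons j l ih =>
      have h := ih.1.pderivC_iterate_bargmann j (α j)
      simp only [List.foldr_cons, ih.2, h.2, List.map_cons, List.prod_cons, mul_assoc]
      exact ⟨h.1, trivial⟩
  simpa only [mpow, conjC, Fin.prod_univ_def, mderiv] using key (List.finRange n)

/-! ### The reproducing formula -/

theorem dotC_comm (z w : Fin n → ℂ) : dotC z w = dotC w z := by
  simp only [dotC, mul_comm]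

theorem dotC_add_left (z z' w : Fin n → ℂ) : dotC (z + z') w = dotC z w + dotC z' w := by
  simp [dotC, add_mul, Finset.sum_add_distrib]

theorem dotC_sub_left (z z' w : Fin n → ℂ) : dotC (z - z') w = dotC z w - dotC z' w := by
  simp [dotC, sub_mul]

theorem dotC_neg_left (z w : Fin n → ℂ) : dotC (-z) w = -dotC z w := by
  simp [dotC]

theorem dotC_add_right (z w w' : Fin n → ℂ) : dotC z (w + w') = dotC z w + dotC z w' := by
  rw [dotC_comm, dotC_add_left, dotC_comm w, dotC_comm w']

theorem dotC_sub_right (z w w' : Fin n → ℂ) : dotC z (w - w') = dotC z w - dotC z w' := by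
  rw [dotC_comm, dotC_sub_left, dotC_comm w, dotC_comm w']

theorem dotC_neg_right (z w : Fin n → ℂ) : dotC z (-w) = -dotC z w := by
  rw [dotC_comm, dotC_neg_left, dotC_comm w]

theorem conjC_conjC (z : Fin n → ℂ) : conjC (conjC z) = z := by
  ext j; simp [conjC]

theorem conjC_add (z w : Fin n → ℂ) : conjC (z + w) = conjC z + conjC w := by
  ext j; simp [conjC]

theorem conjC_sub (z w : Fin n → ℂ) : conjC (z - w) = conjC z - conjC w := by
  ext j; simp [conjC]

theorem conjC_neg (z : Fin n → ℂ) : conjC (-z) = -conjC z := by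
  ext j; simp [conjC]

theorem conj_dotC (z w : Fin n → ℂ) : conj (dotC z w) = dotC (conjC z) (conjC w) := by
  simp [dotC, conjC]

/-- `|z|² = z · conj(z)`, which turns identities between Gaussian exponents into bilinear
algebra. -/
theorem ofReal_normSqC (z : Fin n → ℂ) : (normSqC z : ℂ) = dotC z (conjC z) := by
  simp [normSqC, dotC, conjC, Complex.mul_conj']

/-- An entire function is at the origin equal to its Gaussian mean: average over the rotations
`w ↦ exp(iθ) w`, which preserve the Gaussian measure, and use the one-variable mean value property
on each complex line through the origin. -/
theorem integral_gaussC_eq_apply_zero {f : (Fin n → ℂ) → ℂ} (hf : Differentiable ℂ f)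
    (hi : Integrable f (gaussC n)) : ∫ w, f w ∂(gaussC n) = f 0 := by
  have hmp : ∀ θ : ℝ, MeasurePreserving (fun w : Fin n → ℂ => circleMap 0 1 θ • w)
      (gaussC n) (gaussC n) := fun θ => by
    have hc : ‖circleMap 0 1 θ‖ = 1 := by simp
    have hm : Measurable (fun w : Fin n → ℂ => circleMap 0 1 θ • w) := by fun_prop
    have hv : MeasurePreserving (fun w : Fin n → ℂ => circleMap 0 1 θ • w) :=
      volume_preserving_pi fun _ =>
        (rotation ⟨circleMap 0 1 θ, by simp [Submonoid.unitSphere]⟩).measurePreserving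
    refine ⟨hm, ?_⟩
    ext s hs
    rw [Measure.map_apply hm hs, gaussC, withDensity_apply _ (hm hs), withDensity_apply _ hs,
      ← hv.setLIntegral_comp_preimage hs measurable_gaussDensity]
    congr! 5 with w
    simp [normSqC]
  have hsm : AEStronglyMeasurable (fun p : ℝ × (Fin n → ℂ) => f (circleMap 0 1 p.1 • p.2))
      ((volume.restrict (Set.Ioc 0 (2 * Real.pi))).prod (gaussC n)) :=
    (hf.continuous.comp (by fun_prop)).aestronglyMeasurable
  have hint : Integrable (fun p : ℝ × (Fin n → ℂ) => f (circleMap 0 1 p.1 • p.2))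
      ((volume.restrict (Set.Ioc 0 (2 * Real.pi))).prod (gaussC n)) := by
    refine (integrable_prod_iff hsm).2 ⟨Filter.Eventually.of_forall fun θ =>
      (hmp θ).integrable_comp_of_integrable hi, ?_⟩
    have : ∀ θ : ℝ, ∫ w, ‖f (circleMap 0 1 θ • w)‖ ∂(gaussC n) = ∫ w, ‖f w‖ ∂(gaussC n) :=
      fun θ => by
        have h := integral_map (μ := gaussC n) (hmp θ).aemeasurable
          (f := fun w => ‖f w‖) hf.continuous.norm.aestronglyMeasurable
        rw [(hmp θ).map_eq] at h
        exact h.symm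
    simp only [this]
    exact integrable_const _
  have hswap := integral_integral_swap (f := fun (θ : ℝ) (w : Fin n → ℂ) =>
    f (circleMap 0 1 θ • w)) hint
  have h1 : ∀ θ : ℝ, ∫ w, f (circleMap 0 1 θ • w) ∂(gaussC n) = ∫ w, f w ∂(gaussC n) := fun θ => by
    have h := integral_map (μ := gaussC n) (hmp θ).aemeasurable
      (f := f) hf.continuous.aestronglyMeasurable
    rw [(hmp θ).map_eq] at h
    exact h.symm
  have h2 : ∀ w : Fin n → ℂ, ∫ θ in Set.Ioc 0 (2 * Real.pi), f (circleMap 0 1 θ • w) =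
      (2 * Real.pi : ℝ) • f 0 := fun w => by
    have hd : Differentiable ℂ (fun c : ℂ => f (c • w)) := hf.comp (by fun_prop)
    have h := (hd.diffContOnCl (s := Metric.ball 0 |1|)).circleAverage
    rw [Real.circleAverage_def, intervalIntegral.integral_of_le (by positivity)] at h
    simp only [zero_smul] at h
    rw [← h, smul_smul, mul_inv_cancel₀ (by positivity), one_smul]
  simp only [h1, h2, integral_const, measureReal_restrict_apply, MeasurableSet.univ, Set.univ_inter,
    probReal_univ, one_smul] at hswap
  rw [Real.volume_real_Ioc_of_le (by positivity), sub_zero] at hswap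
  exact smul_right_injective ℂ (show (2 * Real.pi : ℝ) ≠ 0 by positivity) hswap

theorem Fock.inner_def (f g : Fock n) : inner ℂ f g = ∫ z, conj (f z) * g z ∂(gaussC n) := rfl

theorem Fock.expIntegrable (f : Fock n) : ExpIntegrable f := .of_memLp f.memLp

theorem Fock.continuous (f : Fock n) : Continuous f := f.differentiable.continuous

/-- The reproducing formula: translating by a Weyl operator reduces it to the value at the
origin. -/
theorem Fock.bargmann_eq (f : Fock n) (z : Fin n → ℂ) : bargmann f z = f z := by
  have hmem := weylFun_mem (-z) f
  have h0 := integral_gaussC_eq_apply_zero hmem.1 (hmem.2.integrable (by norm_num))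
  have h1 : weylFun (-z) f 0 = Complex.exp (-(normSqC z / 2 : ℝ)) * f z := by
    have e : normSqC (-z) = normSqC z := by simp [normSqC]
    have e' : dotC 0 (conjC (-z)) = 0 := by simp [dotC]
    simp [weylFun, e, e']
  have h2 : ∫ w, weylFun (-z) f w ∂(gaussC n) =
      Complex.exp (-(normSqC z / 2 : ℝ)) * bargmann f z := by
    rw [bargmann, integral_gaussC, integral_gaussC, mul_left_comm]
    congr 1
    rw [← integral_const_mul, ← integral_sub_right_eq_self
      (fun w => weylFun (-z) f w * (Real.exp (-normSqC w) : ℂ)) z]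
    congr 1; ext w
    have e : normSqC (-z) = normSqC z := by simp [normSqC]
    simp only [weylFun, e, sub_neg_eq_add, sub_add_cancel]
    rw [mul_right_comm, ← mul_assoc, ← mul_assoc, mul_right_comm _ (f w), Complex.ofReal_exp,
      Complex.ofReal_exp, ← Complex.exp_add, ← Complex.exp_add, ← Complex.exp_add]
    congr 2
    push_cast
    simp only [ofReal_normSqC, dotC_sub_left, conjC_sub, dotC_sub_right, conjC_neg, dotC_neg_right]
    ring
  rw [h1, h2] at h0
  exact mul_left_cancel₀ (Complex.exp_ne_zero _) h0

theorem conj_kernel_apply (z w : Fin n → ℂ) :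
    conj (kernel z w) = Complex.exp (dotC z (conjC w)) := by
  change conj (Complex.exp (dotC (conjC z) w)) = _
  rw [← Complex.exp_conj, conj_dotC, conjC_conjC]

theorem kernel_apply (z w : Fin n → ℂ) : kernel z w = Complex.exp (dotC (conjC z) w) := rfl

theorem inner_kernel_left (z : Fin n → ℂ) (f : Fock n) : inner ℂ (kernel z) f = f z := by
  rw [← f.bargmann_eq z, Fock.inner_def, bargmann]
  simp only [conj_kernel_apply]

theorem Fock.mderiv_eq (f : Fock n) (α : Fin n → ℕ) :
    mderiv α f = bargmann (fun w => mpow (conjC w) α * f w) := by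
  rw [← (f.expIntegrable.mderiv_bargmann α).2]
  congr 1; ext z; exact (f.bargmann_eq z).symm

theorem Fock.expIntegrable_mpow (f : Fock n) (α : Fin n → ℕ) :
    ExpIntegrable (fun w => mpow (conjC w) α * f w) := (f.expIntegrable.mderiv_bargmann α).1

theorem Fock.continuous_mderiv (f : Fock n) (α : Fin n → ℕ) : Continuous (mderiv α f) := by
  rw [f.mderiv_eq]; exact (f.expIntegrable_mpow α).differentiable_bargmann.continuous

theorem Fock.mderiv_add (f g : Fock n) (α : Fin n → ℕ) (z : Fin n → ℂ) :
    mderiv α (f + g : Fock n) z = mderiv α f z + mderiv α g z := by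
  simp only [Fock.mderiv_eq, bargmann, Fock.add_apply]
  rw [← integral_add ((f.expIntegrable_mpow α).integrable_exp_mul z)
    ((g.expIntegrable_mpow α).integrable_exp_mul z)]
  congr 1; ext w; ring

theorem Fock.mderiv_smul (c : ℂ) (f : Fock n) (α : Fin n → ℕ) (z : Fin n → ℂ) :
    mderiv α (c • f : Fock n) z = c * mderiv α f z := by
  simp only [Fock.mderiv_eq, bargmann, Fock.smul_apply]
  rw [← integral_const_mul]
  congr 1; ext w; ring

theorem pderivC_iterate_const_mul_kernel (c : ℂ) (z : Fin n → ℂ) (j : Fin n) (a : ℕ) :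
    (pderivC j)^[a] (fun w => c * Complex.exp (dotC (conjC z) w)) =
      fun w => conj (z j) ^ a * c * Complex.exp (dotC (conjC z) w) := by
  induction a with
  | zero => simp
  | succ a ih =>
    rw [Function.iterate_succ_apply', ih]
    ext w
    have h := (hasFDerivAt_exp_dotC_conjC z w).const_mul (conj (z j) ^ a * c)
    have hj : dotConjCLM z (Pi.single j 1) = conj (z j) := by
      simp [dotConjCLM, Pi.single_apply]
    simp only [dotC_comm (conjC z), pderivC]
    rw [h.fderiv, smul_apply, smul_apply, hj, smul_eq_mul, smul_eq_mul]
    ring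

/-- The derivatives of the reproducing kernel. -/
theorem mderiv_kernel (α : Fin n → ℕ) (z w : Fin n → ℂ) :
    mderiv α (kernel z) w = mpow (conjC z) α * kernel z w := by
  have key : ∀ l : List (Fin n),
      l.foldr (fun j g => (pderivC j)^[α j] g) (fun w => Complex.exp (dotC (conjC z) w)) =
        fun w => (l.map fun j => conj (z j) ^ α j).prod * Complex.exp (dotC (conjC z) w) :=
    fun l => by
      induction l with
      | nil => simp
      | cons j l ih =>
        rw [List.foldr_cons, ih, pderivC_iterate_const_mul_kernel, List.map_cons, List.prod_cons]
  have := congrFun (key (List.finRange n)) w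
  rw [mpow, Fin.prod_univ_def]
  exact this

/-! ### Completeness, and density of the reproducing kernels -/

/-- The isometric inclusion of the Fock space into `L²(γₙ)`. -/
def Fock.toLp : Fock n →ₗᵢ[ℂ] Lp ℂ 2 (gaussC n) :=
  LinearMap.isometryOfInner
    { toFun := fun f => f.memLp.toLp f
      map_add' := fun _ _ => rfl
      map_smul' := fun _ _ => rfl } fun f g => by
    rw [L2.inner_def, Fock.inner_def]
    refine integral_congr_ae ?_
    filter_upwards [f.memLp.coeFn_toLp, g.memLp.coeFn_toLp] with w hf hg
    rw [RCLike.inner_apply, mul_comm]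
    exact (congrArg₂ (fun a b => conj a * b) hf hg).symm ▸ rfl

theorem Fock.coeFn_toLp (f : Fock n) : Fock.toLp f =ᵐ[gaussC n] f := f.memLp.coeFn_toLp

theorem inner_toLp_kernel (z : Fin n → ℂ) (F : Lp ℂ 2 (gaussC n)) :
    inner ℂ (Fock.toLp (kernel z)) F = bargmann F z := by
  rw [L2.inner_def, bargmann]
  refine integral_congr_ae ?_
  filter_upwards [Fock.coeFn_toLp (kernel z)] with w hw
  simp only [hw, RCLike.inner_apply, conj_kernel_apply, mul_comm]

/-- The range of the inclusion into `L²` is closed: an `L²`-limit of elements of the Fock space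
agrees almost everywhere with its own Bargmann integral, which is entire. -/
theorem Fock.isClosed_range_toLp : IsClosed (Set.range (Fock.toLp (n := n))) := by
  refine isClosed_of_closure_subset fun F hF => ?_
  obtain ⟨u, hu, hlim⟩ := mem_closure_iff_seq_limit.1 hF
  choose f hf using hu
  have hpt : ∀ z, Filter.Tendsto (fun i => f i z) Filter.atTop (nhds (bargmann F z)) := fun z => by
    have := (tendsto_const_nhds (x := Fock.toLp (kernel z))).inner (𝕜 := ℂ) hlim
    rw [inner_toLp_kernel] at this
    refine this.congr fun i => ?_
    rw [← hf, LinearIsometry.inner_map_map, inner_kernel_left]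
  obtain ⟨φ, hφ, hae⟩ := (tendstoInMeasure_of_tendsto_Lp hlim).exists_seq_tendsto_ae
  have hall : ∀ᵐ w ∂(gaussC n), ∀ i, u i w = f i w := by
    refine ae_all_iff.2 fun i => ?_
    rw [← hf]; exact Fock.coeFn_toLp (f i)
  have heq : (F : (Fin n → ℂ) → ℂ) =ᵐ[gaussC n] bargmann F := by
    filter_upwards [hae, hall] with w hw hw'
    refine tendsto_nhds_unique hw ?_
    simp only [hw']
    exact (hpt w).comp hφ.tendsto_atTop
  have hmem : bargmann F ∈ fockSubmodule n :=
    ⟨(ExpIntegrable.of_memLp (Lp.memLp F)).differentiable_bargmann, (Lp.memLp F).ae_eq heq⟩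
  refine ⟨⟨bargmann F, hmem⟩, Lp.ext ((Fock.coeFn_toLp _).trans heq.symm)⟩

instance Fock.completeSpace : CompleteSpace (Fock n) :=
  (completeSpace_iff_isComplete_range Fock.toLp.isometry.isUniformInducing).2
    Fock.isClosed_range_toLp.isComplete

/-- Bounded operators that agree on the reproducing kernels are equal. -/
theorem Fock.clm_ext_kernel {S T : Fock n →L[ℂ] Fock n} (h : ∀ z, S (kernel z) = T (kernel z)) :
    S = T := by
  have : (Submodule.span ℂ (Set.range (kernel (n := n)))).topologicalClosure = ⊤ := by
    rw [Submodule.topologicalClosure_eq_top_iff, Submodule.eq_bot_iff]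
    intro f hf
    refine Fock.ext fun z => ?_
    rw [← inner_kernel_left z f]
    exact hf _ (Submodule.subset_span ⟨z, rfl⟩)
  refine ContinuousLinearMap.ext_on (s := Set.range kernel) ?_ ?_
  · rw [dense_iff_closure_eq, ← Submodule.topologicalClosure_coe, this]; rfl
  · rintro _ ⟨z, rfl⟩; exact h z

/-! ### Weyl operators -/

theorem weyl_apply (h : Fin n → ℂ) (f : Fock n) (z : Fin n → ℂ) :
    weyl h f z = Complex.exp (dotC z (conjC h) - (normSqC h / 2 : ℝ)) * f (z - h) := rfl

theorem inner_weyl (h : Fin n → ℂ) (f g : Fock n) :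
    inner ℂ (weyl h f) (weyl h g) = inner ℂ f g := by
  rw [Fock.inner_def, Fock.inner_def, integral_gaussC, integral_gaussC]
  congr 1
  rw [← integral_sub_right_eq_self (fun z => conj (f z) * g z * (Real.exp (-normSqC z) : ℂ)) h]
  congr 1; ext z
  simp only [weyl_apply, map_mul, ← Complex.exp_conj, map_sub, Complex.conj_ofReal]
  have e : (Real.exp (-normSqC (z - h)) : ℂ) =
      Complex.exp (conj (dotC z (conjC h)) - (normSqC h / 2 : ℝ)) *
      Complex.exp (dotC z (conjC h) - (normSqC h / 2 : ℝ)) * (Real.exp (-normSqC z) : ℂ) := by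
    rw [Complex.ofReal_exp, Complex.ofReal_exp, ← Complex.exp_add, ← Complex.exp_add]
    congr 1
    push_cast
    simp only [ofReal_normSqC, conj_dotC, conjC_conjC, conjC_sub, dotC_sub_left, dotC_sub_right]
    rw [dotC_comm h (conjC z)]
    ring
  rw [e]; ring

/-- The Weyl operators as linear isometries. -/
def weylIsometry (h : Fin n → ℂ) : Fock n →ₗᵢ[ℂ] Fock n :=
  (weyl h).isometryOfInner (inner_weyl h)

/-- Weyl operators permute the reproducing kernels, up to nonzero scalars. -/
theorem weyl_kernel (h z : Fin n → ℂ) :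
    weyl h (kernel z) =
      Complex.exp (-dotC (conjC z) h - (normSqC h / 2 : ℝ)) • kernel (z + h) := by
  refine Fock.ext fun w => ?_
  rw [weyl_apply, Fock.smul_apply, kernel_apply, kernel_apply, ← Complex.exp_add,
    ← Complex.exp_add, conjC_add, dotC_add_left, dotC_sub_right, dotC_comm w]
  congr 1; ring

/-! ### Polynomial weights and measures of bounded mass on unit polydisks -/

/-- The weight `∏ⱼ (1 + |zⱼ|)^{mⱼ}`, the growth rate of derivatives of total order `m`. -/
def polyWeight (m : Fin n → ℕ) (z : Fin n → ℂ) : ℝ := ∏ j, (1 + ‖z j‖) ^ m j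

theorem continuous_polyWeight (m : Fin n → ℕ) : Continuous (polyWeight m) := by
  unfold polyWeight; fun_prop

theorem polyWeight_pos (m : Fin n → ℕ) (z : Fin n → ℂ) : 0 < polyWeight m z :=
  Finset.prod_pos fun _ _ => by positivity

theorem one_le_polyWeight (m : Fin n → ℕ) (z : Fin n → ℂ) : 1 ≤ polyWeight m z :=
  Finset.one_le_prod fun _ _ => one_le_pow₀ (by simp)

theorem polyWeight_add (α β : Fin n → ℕ) (z : Fin n → ℂ) :
    polyWeight (α + β) z = polyWeight α z * polyWeight β z := by
  simp [polyWeight, pow_add, Finset.prod_mul_distrib]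

/-- The measure with density `∏ⱼ (1 + |zⱼ|)^{mⱼ}` with respect to `μ`. -/
def polyWeighted (m : Fin n → ℕ) (μ : Measure (Fin n → ℂ)) : Measure (Fin n → ℂ) :=
  μ.withDensity fun z => ENNReal.ofReal (polyWeight m z)

theorem measurable_ofReal_polyWeight (m : Fin n → ℕ) :
    Measurable fun z => ENNReal.ofReal (polyWeight m z) :=
  (continuous_polyWeight m).measurable.ennreal_ofReal

theorem le_polyWeighted (m : Fin n → ℕ) (μ : Measure (Fin n → ℂ)) : μ ≤ polyWeighted m μ := by
  conv_lhs => rw [← withDensity_one (μ := μ)]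
  refine withDensity_mono (Filter.Eventually.of_forall fun z => ?_)
  simpa using one_le_polyWeight m z

instance (m : Fin n → ℕ) (μ : Measure (Fin n → ℂ)) [SFinite μ] : SFinite (polyWeighted m μ) :=
  inferInstanceAs (SFinite (μ.withDensity _))

/-- The masses of the polydisks of polyradius `(1, …, 1)` are uniformly bounded. -/
def BallBounded (ν : Measure (Fin n → ℂ)) : Prop :=
  ∃ C : ℝ≥0, ∀ z, ν (Metric.ball z 1) ≤ C

theorem normSqC_add_le (z w : Fin n → ℂ) : normSqC (z + w) ≤ 2 * normSqC z + 2 * normSqC w := by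
  simp only [normSqC, Finset.mul_sum, ← Finset.sum_add_distrib]
  refine Finset.sum_le_sum fun j _ => ?_
  have h1 : ‖z j + w j‖ ^ 2 ≤ (‖z j‖ + ‖w j‖) ^ 2 :=
    pow_le_pow_left₀ (norm_nonneg _) (norm_add_le _ _) 2
  rw [Pi.add_apply]
  nlinarith [sq_nonneg (‖z j‖ - ‖w j‖)]

theorem normSqC_sub_comm (z w : Fin n → ℂ) : normSqC (z - w) = normSqC (w - z) := by
  simp only [normSqC, Pi.sub_apply, norm_sub_rev]

theorem normSqC_le {z : Fin n → ℂ} {r : ℝ} (h : ∀ j, ‖z j‖ ≤ r) : normSqC z ≤ n * r ^ 2 := by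
  refine (Finset.sum_le_sum fun j _ => pow_le_pow_left₀ (norm_nonneg _) (h j) 2).trans ?_
  simp

theorem ballBounded_polyWeighted_of_weighted {k : Fin n → ℝ} {m : Fin n → ℕ}
    (hk : ∀ j, k j = (m j : ℝ) / 2) {μ : Measure (Fin n → ℂ)} (h : BallBounded (weighted μ k)) :
    BallBounded (polyWeighted m μ) := by
  obtain ⟨C, hC⟩ := h
  set D : ℝ := ∏ j, (2 : ℝ) ^ k j with hD
  have hD0 : 0 ≤ D := Finset.prod_nonneg fun j _ => by positivity
  have hle : ∀ z, polyWeight m z ≤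
      D * ∏ j, (1 + (z j).re ^ 2) ^ k j * (1 + (z j).im ^ 2) ^ k j := fun z => by
    rw [hD, ← Finset.prod_mul_distrib]
    refine Finset.prod_le_prod (fun j _ => by positivity) fun j _ => ?_
    have hkj : 0 ≤ k j := by rw [hk]; positivity
    have h1 : (1 + ‖z j‖) ^ m j = ((1 + ‖z j‖) ^ 2) ^ k j := by
      rw [hk, ← Real.rpow_natCast, ← Real.rpow_natCast, ← Real.rpow_mul (by positivity)]
      congr 1; push_cast; ring
    rw [h1, ← Real.mul_rpow (by positivity) (by positivity),
      ← Real.mul_rpow (by positivity) (by positivity)]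
    refine Real.rpow_le_rpow (by positivity) ?_ hkj
    have h2 : ‖z j‖ ^ 2 = (z j).re ^ 2 + (z j).im ^ 2 := by
      rw [← Complex.normSq_eq_norm_sq, Complex.normSq_apply]; ring
    nlinarith [sq_nonneg (1 - ‖z j‖), sq_nonneg ((z j).re * (z j).im)]
  refine ⟨D.toNNReal * C, fun z => ?_⟩
  have hz := hC z
  rw [weighted, withDensity_apply _ Metric.isOpen_ball.measurableSet] at hz
  rw [polyWeighted, withDensity_apply _ Metric.isOpen_ball.measurableSet]
  calc ∫⁻ w in Metric.ball z 1, ENNReal.ofReal (polyWeight m w) ∂μ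
      ≤ ∫⁻ w in Metric.ball z 1, ENNReal.ofReal D * ENNReal.ofReal
          (∏ j, (1 + (w j).re ^ 2) ^ k j * (1 + (w j).im ^ 2) ^ k j) ∂μ :=
        lintegral_mono fun w => by
          rw [← ENNReal.ofReal_mul hD0]; exact ENNReal.ofReal_le_ofReal (hle w)
    _ = ENNReal.ofReal D * ∫⁻ w in Metric.ball z 1, ENNReal.ofReal
          (∏ j, (1 + (w j).re ^ 2) ^ k j * (1 + (w j).im ^ 2) ^ k j) ∂μ :=
        lintegral_const_mul' _ _ ENNReal.ofReal_ne_top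
    _ ≤ ENNReal.ofReal D * C := by gcongr
    _ = _ := by rw [ENNReal.coe_mul, ENNReal.ofReal]

theorem norm_mpow (z : Fin n → ℂ) (α : Fin n → ℕ) : ‖mpow z α‖ = ∏ j, ‖z j‖ ^ α j := by
  simp [mpow]

theorem norm_mpow_conjC (z : Fin n → ℂ) (α : Fin n → ℕ) : ‖mpow (conjC z) α‖ = ‖mpow z α‖ := by
  simp [norm_mpow, conjC]

theorem norm_kernel_sq_mul_exp (a w : Fin n → ℂ) :
    ‖kernel a w‖ ^ 2 * Real.exp (-normSqC w) =
      Real.exp (normSqC a) * Real.exp (-normSqC (w - a)) := by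
  rw [kernel_apply, Complex.norm_exp, ← Real.exp_nat_mul, ← Real.exp_add, ← Real.exp_add,
    normSqC_sub, dotC_comm w]
  congr 1; push_cast; ring

/-- The Carleson inequality, tested on the reproducing kernel at `a`. -/
theorem CarlesonIneq.exists_bound {p : Fin n → ℕ} {μ : Measure (Fin n → ℂ)}
    (h : CarlesonIneq p μ) : ∃ D : ℝ≥0, ∀ a : Fin n → ℂ,
      ENNReal.ofReal (‖mpow a p‖ ^ 2) * ∫⁻ w, ENNReal.ofReal (Real.exp (-normSqC (w - a))) ∂μ ≤
        D := by
  obtain ⟨ω, hω⟩ := h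
  refine ⟨ω * (Real.pi ^ n).toNNReal, fun a => ?_⟩
  have ha := hω (kernel a)
  simp only [mderiv_kernel, norm_mul, mul_pow, norm_mpow_conjC, mul_assoc,
    norm_kernel_sq_mul_exp] at ha
  have h1 : ∀ w, ENNReal.ofReal (‖mpow a p‖ ^ 2 *
      (Real.exp (normSqC a) * Real.exp (-normSqC (w - a)))) =
      ENNReal.ofReal (Real.exp (normSqC a)) * (ENNReal.ofReal (‖mpow a p‖ ^ 2) *
        ENNReal.ofReal (Real.exp (-normSqC (w - a)))) := fun w => by
    rw [← ENNReal.ofReal_mul (by positivity), ← ENNReal.ofReal_mul (by positivity)]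
    congr 1; ring
  have h2 : ∀ w, ENNReal.ofReal (Real.exp (normSqC a) * Real.exp (-normSqC (w - a))) =
      ENNReal.ofReal (Real.exp (normSqC a)) * ENNReal.ofReal (Real.exp (-normSqC (w - a))) :=
    fun w => ENNReal.ofReal_mul (by positivity)
  have h3 : ∫⁻ w : Fin n → ℂ, ENNReal.ofReal (Real.exp (-normSqC (w - a))) =
      ENNReal.ofReal (Real.pi ^ n) := by
    rw [lintegral_sub_right_eq_self (fun w => ENNReal.ofReal (Real.exp (-normSqC w))),
      ← ofReal_integral_eq_lintegral_ofReal integrable_exp_neg_normSqC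
        (Filter.Eventually.of_forall fun z => by positivity), integral_exp_neg_normSqC]
  simp only [h1, h2] at ha
  rw [lintegral_const_mul' _ _ ENNReal.ofReal_ne_top,
    lintegral_const_mul' _ _ ENNReal.ofReal_ne_top, lintegral_const_mul' _ _ ENNReal.ofReal_ne_top, h3, mul_left_comm (ω : ℝ≥0∞),
    ENNReal.mul_le_mul_iff_right (by simp [Real.exp_pos]) ENNReal.ofReal_ne_top] at ha
  rw [ENNReal.coe_mul]
  exact ha

theorem ballBounded_polyWeighted_of_carlesonIneq {p : Fin n → ℕ} {μ : Measure (Fin n → ℂ)}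
    (h : CarlesonIneq p μ) : BallBounded (polyWeighted (2 • p) μ) := by
  obtain ⟨D, hD⟩ := h.exists_bound
  set A : ℝ := Real.exp (9 * n) * ∏ j, (2 : ℝ) ^ (2 * p j) with hA
  have hA0 : 0 ≤ A := by positivity
  refine ⟨A.toNNReal * D, fun z => ?_⟩
  -- The test point is shifted away from the coordinate hyperplanes, where `z^p` vanishes.
  set a : Fin n → ℂ := fun j => if 0 ≤ (z j).re then z j + 2 else z j - 2 with ha
  have ha2 : ∀ j, ‖z j - a j‖ = 2 := fun j => by
    simp only [ha]; split_ifs <;> simp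
  have haz : ∀ j, ‖z j‖ ^ 2 + 4 ≤ ‖a j‖ ^ 2 := fun j => by
    simp only [ha, ← Complex.normSq_eq_norm_sq, Complex.normSq_apply]
    split_ifs with h0 <;> simp <;> nlinarith
  have haz' : ∀ j, 2 + ‖z j‖ ≤ 2 * ‖a j‖ := fun j => by
    have := haz j
    have h1 : 2 ≤ ‖a j‖ :=
      abs_le_of_sq_le_sq' (by nlinarith [norm_nonneg (z j)]) (norm_nonneg _) |>.2
    have h2 : ‖z j‖ ≤ ‖a j‖ := abs_le_of_sq_le_sq' (by linarith) (norm_nonneg _) |>.2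
    linarith
  rw [polyWeighted, withDensity_apply _ Metric.isOpen_ball.measurableSet]
  calc ∫⁻ w in Metric.ball z 1, ENNReal.ofReal (polyWeight (2 • p) w) ∂μ
      ≤ ∫⁻ w in Metric.ball z 1, ENNReal.ofReal A * (ENNReal.ofReal (‖mpow a p‖ ^ 2) *
          ENNReal.ofReal (Real.exp (-normSqC (w - a)))) ∂μ := by
        refine setLIntegral_mono' Metric.isOpen_ball.measurableSet fun w hw => ?_
        rw [← ENNReal.ofReal_mul (by positivity), ← ENNReal.ofReal_mul hA0]
        refine ENNReal.ofReal_le_ofReal ?_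
        have hwz : ∀ j, ‖w j - z j‖ ≤ 1 := fun j =>
          (norm_le_pi_norm (w - z) j).trans (mem_ball_iff_norm.1 hw).le
        have h1 : polyWeight (2 • p) w ≤ (∏ j, (2 : ℝ) ^ (2 * p j)) * ‖mpow a p‖ ^ 2 := by
          rw [norm_mpow, ← Finset.prod_pow, ← Finset.prod_mul_distrib]
          refine Finset.prod_le_prod (fun j _ => by positivity) fun j _ => ?_
          rw [← pow_mul, mul_comm (p j) 2, ← mul_pow, Pi.smul_apply, smul_eq_mul]
          refine pow_le_pow_left₀ (by positivity) ?_ _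
          have := norm_add_le (w j - z j) (z j)
          rw [sub_add_cancel] at this
          linarith [hwz j, haz' j]
        have h2 : 1 ≤ Real.exp (9 * n) * Real.exp (-normSqC (w - a)) := by
          rw [← Real.exp_add, Real.one_le_exp_iff]
          have : normSqC (w - a) ≤ n * 3 ^ 2 := normSqC_le fun j => by
            have := norm_add_le (w j - z j) (z j - a j)
            rw [sub_add_sub_cancel] at this
            rw [Pi.sub_apply]
            linarith [hwz j, ha2 j]
          linarith
        calc polyWeight (2 • p) w
            ≤ ((∏ j, (2 : ℝ) ^ (2 * p j)) * ‖mpow a p‖ ^ 2) *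
              (Real.exp (9 * n) * Real.exp (-normSqC (w - a))) :=
              h1.trans (le_mul_of_one_le_right (by positivity) h2)
          _ = _ := by rw [hA]; ring
    _ = ENNReal.ofReal A * (ENNReal.ofReal (‖mpow a p‖ ^ 2) *
          ∫⁻ w in Metric.ball z 1, ENNReal.ofReal (Real.exp (-normSqC (w - a))) ∂μ) := by
        rw [lintegral_const_mul' _ _ ENNReal.ofReal_ne_top,
          lintegral_const_mul' _ _ ENNReal.ofReal_ne_top]
    _ ≤ ENNReal.ofReal A * (ENNReal.ofReal (‖mpow a p‖ ^ 2) *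
          ∫⁻ w, ENNReal.ofReal (Real.exp (-normSqC (w - a))) ∂μ) := by
        gcongr
        exact Measure.restrict_le_self
    _ ≤ ENNReal.ofReal A * D := by gcongr; exact hD a
    _ = _ := by rw [ENNReal.coe_mul, ENNReal.ofReal]

/-- Both alternatives in the definition of a `k`-FC measure give the same mass bound, with the weight
`∏ⱼ (1 + |zⱼ|)^{2kⱼ}`. -/
theorem IsKFC.ballBounded {k : Fin n → ℝ} {m : Fin n → ℕ} (hk : ∀ j, k j = (m j : ℝ) / 2)
    {μ : Measure (Fin n → ℂ)} (h : IsKFC k μ) : BallBounded (polyWeighted m μ) := by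
  obtain ⟨p, hp, hc⟩ | h := h
  · have : m = 2 • p := by
      ext j
      have := (hk j).symm.trans (hp j)
      rw [div_eq_iff two_ne_zero] at this
      rw [Pi.smul_apply, smul_eq_mul, mul_comm]
      exact_mod_cast this
    rw [this]
    exact ballBounded_polyWeighted_of_carlesonIneq hc
  · exact ballBounded_polyWeighted_of_weighted hk h

/-- A measure of bounded mass on unit polydisks has bounded Gaussian averages: compare the Gaussian
with its means over polydisks and use Tonelli's theorem. -/
theorem BallBounded.exists_lintegral_exp_le {ν : Measure (Fin n → ℂ)} [SFinite ν]
    (h : BallBounded ν) {c : ℝ} (hc : 0 < c) : ∃ D : ℝ≥0, ∀ w,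
      ∫⁻ z, ENNReal.ofReal (Real.exp (-c * normSqC (z - w))) ∂ν ≤ D := by
  obtain ⟨C, hC⟩ := h
  set V := (volume : Measure (Fin n → ℂ)) (Metric.ball 0 1) with hV
  have hV0 : V ≠ 0 := (Metric.measure_ball_pos _ _ one_pos).ne'
  have hVt : V ≠ ∞ := measure_ball_lt_top.ne
  set g : (Fin n → ℂ) → ℝ≥0∞ := fun u =>
    ENNReal.ofReal (Real.exp (c * n) * Real.exp (-(c / 2) * normSqC u))
  have hgm : Measurable g := by
    have := (continuous_normSqC (n := n)).measurable
    fun_prop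
  set K := ∫⁻ u, g u
  have hKt : K ≠ ∞ := by
    have := ((integrable_exp_neg_mul_normSqC (n := n) (half_pos hc)).const_mul (Real.exp (c * n)))
    exact (this.lintegral_lt_top).ne
  have hfin : C * K / V ≠ ∞ :=
    ENNReal.div_ne_top (ENNReal.mul_ne_top ENNReal.coe_ne_top hKt) hV0
  refine ⟨(C * K / V).toNNReal, fun w => ?_⟩
  rw [ENNReal.coe_toNNReal hfin, ENNReal.le_div_iff_mul_le (.inl hV0) (.inl hVt), mul_comm,
    ← lintegral_const_mul' _ _ hVt]
  have hS : MeasurableSet {p : (Fin n → ℂ) × (Fin n → ℂ) | dist p.2 p.1 < 1} :=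
    (isOpen_lt (by fun_prop) continuous_const).measurableSet
  have hmeas : Measurable (Function.uncurry fun z u : Fin n → ℂ =>
      {p : (Fin n → ℂ) × (Fin n → ℂ) | dist p.2 p.1 < 1}.indicator
        (fun p => g (p.2 - w)) (z, u)) :=
    (hgm.comp (by fun_prop : Measurable fun p : (Fin n → ℂ) × (Fin n → ℂ) =>
      p.2 - w)).indicator hS
  calc ∫⁻ z, V * ENNReal.ofReal (Real.exp (-c * normSqC (z - w))) ∂ν
      ≤ ∫⁻ z, ∫⁻ u, {p : (Fin n → ℂ) × (Fin n → ℂ) | dist p.2 p.1 < 1}.indicator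
          (fun p => g (p.2 - w)) (z, u) ∂volume ∂ν := by
        refine lintegral_mono fun z => ?_
        have e : ∀ u, {p : (Fin n → ℂ) × (Fin n → ℂ) | dist p.2 p.1 < 1}.indicator
            (fun p => g (p.2 - w)) (z, u) =
            (Metric.ball z 1).indicator (fun u => g (u - w)) u := fun u => rfl
        simp only [e]
        rw [lintegral_indicator Metric.isOpen_ball.measurableSet, mul_comm, hV,
          ← Measure.addHaar_ball_center volume z 1, ← setLIntegral_const]
        refine setLIntegral_mono' Metric.isOpen_ball.measurableSet fun u hu => ?_
        refine ENNReal.ofReal_le_ofReal ?_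
        rw [← Real.exp_add, Real.exp_le_exp]
        have h1 : normSqC (u - w) ≤ 2 * normSqC (u - z) + 2 * normSqC (z - w) := by
          rw [← sub_add_sub_cancel u z w]; exact normSqC_add_le _ _
        have h2 : normSqC (u - z) ≤ n * 1 ^ 2 := normSqC_le fun j =>
          (norm_le_pi_norm (u - z) j).trans (mem_ball_iff_norm.1 hu).le
        nlinarith
    _ = ∫⁻ u, ∫⁻ z, {p : (Fin n → ℂ) × (Fin n → ℂ) | dist p.2 p.1 < 1}.indicator
          (fun p => g (p.2 - w)) (z, u) ∂ν := lintegral_lintegral_swap hmeas.aemeasurable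
    _ = ∫⁻ u, g (u - w) * ν (Metric.ball u 1) := by
        refine lintegral_congr fun u => ?_
        have e : ∀ z, {p : (Fin n → ℂ) × (Fin n → ℂ) | dist p.2 p.1 < 1}.indicator
            (fun p => g (p.2 - w)) (z, u) =
            (Metric.ball u 1).indicator (fun _ => g (u - w)) z := fun z => by
          simp only [Set.indicator, Set.mem_ofPred_eq, Metric.mem_ball, dist_comm u z]
        simp only [e]
        rw [lintegral_indicator Metric.isOpen_ball.measurableSet, setLIntegral_const]
    _ ≤ ∫⁻ u, g (u - w) * C := by gcongr with u; exact hC u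
    _ = C * K := by
        rw [lintegral_mul_const' _ _ ENNReal.coe_ne_top, lintegral_sub_right_eq_self g, mul_comm]

theorem BallBounded.integrable_exp {ν : Measure (Fin n → ℂ)} [SFinite ν]
    (h : BallBounded ν) {c : ℝ} (hc : 0 < c) (w : Fin n → ℂ) :
    Integrable (fun z => Real.exp (-c * normSqC (z - w))) ν := by
  obtain ⟨D, hD⟩ := h.exists_lintegral_exp_le hc
  have hcont : Continuous fun z : Fin n → ℂ => Real.exp (-c * normSqC (z - w)) := by
    have := continuous_normSqC (n := n)
    fun_prop
  exact (lintegral_ofReal_ne_top_iff_integrable hcont.aestronglyMeasurable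
    (Filter.Eventually.of_forall fun z => by positivity)).1
      ((hD w).trans_lt ENNReal.coe_lt_top).ne

theorem BallBounded.mono {μ ν : Measure (Fin n → ℂ)} (h : BallBounded ν) (hle : μ ≤ ν) :
    BallBounded μ := by
  obtain ⟨C, hC⟩ := h
  exact ⟨C, fun z => (hle _).trans (hC z)⟩

/-! ### Boundedness of the coderivative forms -/

theorem sq_lintegral_mul_le {X : Type*} [MeasurableSpace X] {ν : Measure X} {f g : X → ℝ≥0∞}
    (hf : AEMeasurable f ν) (hg : AEMeasurable g ν) :
    (∫⁻ x, f x * g x ∂ν) ^ 2 ≤ (∫⁻ x, f x ^ 2 ∂ν) * ∫⁻ x, g x ^ 2 ∂ν := by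
  have h := ENNReal.lintegral_mul_le_Lp_mul_Lq ν Real.HolderConjugate.two_two hf hg
  have h2 : ∀ a : ℝ≥0∞, (a ^ (1 / 2 : ℝ)) ^ 2 = a := fun a => by
    rw [← ENNReal.rpow_natCast, ← ENNReal.rpow_mul]; norm_num
  refine (pow_le_pow_left' h 2).trans ?_
  rw [mul_pow, h2, h2]
  norm_num

theorem Fock.lintegral_enorm_sq (f : Fock n) :
    ∫⁻ w, ‖f w‖ₑ ^ 2 ∂(gaussC n) = ‖f‖ₑ ^ 2 := by
  have h1 : ‖f‖ = ‖Fock.toLp f‖ := (Fock.toLp.norm_map f).symm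
  have h2 : ‖f‖ₑ = eLpNorm f 2 (gaussC n) := by
    rw [← ofReal_norm, h1]
    change ENNReal.ofReal ‖f.memLp.toLp f‖ = _
    rw [Lp.norm_toLp, ENNReal.ofReal_toReal f.memLp.eLpNorm_ne_top]
  rw [h2, eLpNorm_eq_lintegral_rpow_enorm_toReal (by norm_num) (by norm_num),
    ← ENNReal.rpow_natCast, ← ENNReal.rpow_mul]
  norm_num

/-- The Gaussian average of `|f|²` about `z`. -/
def gaussAverage (f : Fock n) (z : Fin n → ℂ) : ℝ≥0∞ :=
  ∫⁻ w, ENNReal.ofReal (Real.exp (-(1 / 2) * normSqC (z - w))) * ‖f w‖ₑ ^ 2 ∂(gaussC n)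

theorem norm_mpow_le_polyWeight_mul_exp (α : Fin n → ℕ) (z w : Fin n → ℂ) :
    ‖mpow w α‖ ≤ polyWeight α z * Real.exp ((∑ j, α j : ℕ) * normOneC (w - z)) := by
  have h1 : Real.exp (∑ j, α j * ‖w j - z j‖) ≤
      Real.exp ((∑ j, α j : ℕ) * normOneC (w - z)) := by
    rw [Real.exp_le_exp, Nat.cast_sum, Finset.sum_mul]
    refine Finset.sum_le_sum fun j _ => ?_
    gcongr
    exact norm_le_normOneC (w - z) j
  refine le_trans ?_ (mul_le_mul_of_nonneg_left h1 (polyWeight_pos α z).le)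
  rw [Real.exp_sum, polyWeight, ← Finset.prod_mul_distrib, norm_mpow]
  refine Finset.prod_le_prod (fun j _ => by positivity) fun j _ => ?_
  rw [Real.exp_nat_mul, ← mul_pow]
  refine pow_le_pow_left₀ (norm_nonneg _) ?_ _
  have h2 := norm_add_le (w j - z j) (z j)
  rw [sub_add_cancel] at h2
  have h3 := Real.add_one_le_exp ‖w j - z j‖
  nlinarith [norm_nonneg (z j), norm_nonneg (w j - z j)]

/-- The pointwise estimate of derivatives by Gaussian averages, from the Cauchy--Schwarz inequality
in the reproducing formula. -/
theorem exists_enorm_mderiv_sq_le (α : Fin n → ℕ) : ∃ C : ℝ≥0, ∀ (f : Fock n) (z : Fin n → ℂ),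
    (‖mderiv α f z‖ₑ * ENNReal.ofReal (Real.exp (-(1 / 2) * normSqC z) / polyWeight α z)) ^ 2 ≤
      C * gaussAverage f z := by
  set A : ℝ := ((∑ j, α j : ℕ) : ℝ)
  have hcont1 := continuous_normSqC (n := n)
  set g : (Fin n → ℂ) → ℝ≥0∞ := fun v => ENNReal.ofReal
    ((Real.pi ^ n)⁻¹ * Real.exp (2 * A * normOneC v - 1 / 2 * normSqC v)) with hg
  have hgt : ∫⁻ v, g v ≠ ∞ :=
    (((integrable_exp_normOneC_sub (n := n) one_half_pos (2 * A)).const_mul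
      ((Real.pi ^ n)⁻¹)).lintegral_lt_top).ne
  refine ⟨(∫⁻ v, g v).toNNReal, fun f z => ?_⟩
  rw [ENNReal.coe_toNNReal hgt]
  have hP := polyWeight_pos α z
  set a : (Fin n → ℂ) → ℝ≥0∞ := fun w => ENNReal.ofReal (‖mpow w α‖ / polyWeight α z *
    Real.exp (1 / 2 * normSqC w - 1 / 4 * normSqC (z - w))) with ha
  set b : (Fin n → ℂ) → ℝ≥0∞ := fun w =>
    ENNReal.ofReal (Real.exp (-(1 / 4) * normSqC (z - w))) * ‖f w‖ₑ with hb
  have hmpow : Continuous fun w : Fin n → ℂ => mpow w α := by unfold mpow; fun_prop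
  have ham : Measurable a := by
    have : Continuous fun w : Fin n → ℂ => ‖mpow w α‖ / polyWeight α z *
        Real.exp (1 / 2 * normSqC w - 1 / 4 * normSqC (z - w)) := by fun_prop
    exact this.measurable.ennreal_ofReal
  have hbm : Measurable b := by
    have : Continuous fun w : Fin n → ℂ => Real.exp (-(1 / 4) * normSqC (z - w)) := by fun_prop
    exact this.measurable.ennreal_ofReal.mul f.continuous.measurable.enorm
  have h1 : ‖mderiv α f z‖ₑ * ENNReal.ofReal (Real.exp (-(1 / 2) * normSqC z) / polyWeight α z) ≤
      ∫⁻ w, a w * b w ∂(gaussC n) := by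
    rw [f.mderiv_eq, bargmann]
    refine (mul_le_mul_left (enorm_integral_le_lintegral_enorm _) _).trans_eq ?_
    rw [← lintegral_mul_const' _ _ ENNReal.ofReal_ne_top]
    refine lintegral_congr fun w => ?_
    simp only [ha, hb, ← ofReal_norm]
    rw [norm_mul, norm_mul, norm_mpow_conjC, ← ENNReal.ofReal_mul (by positivity),
      ← ENNReal.ofReal_mul (by positivity), ← ENNReal.ofReal_mul (by positivity)]
    congr 1
    have e : ‖Complex.exp (dotC z (conjC w))‖ * Real.exp (-(1 / 2) * normSqC z) =
        Real.exp (1 / 2 * normSqC w - 1 / 4 * normSqC (z - w)) *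
          Real.exp (-(1 / 4) * normSqC (z - w)) := by
      rw [Complex.norm_exp, ← Real.exp_add, ← Real.exp_add, normSqC_sub]
      congr 1; ring
    calc _ = (‖Complex.exp (dotC z (conjC w))‖ * Real.exp (-(1 / 2) * normSqC z)) *
          (‖mpow w α‖ / polyWeight α z * ‖f w‖) := by ring
      _ = _ := by rw [e]; ring
  refine (pow_le_pow_left' h1 2).trans
    ((sq_lintegral_mul_le ham.aemeasurable hbm.aemeasurable).trans ?_)
  refine mul_le_mul' ?_ (le_of_eq ?_)
  · rw [lintegral_gaussC (ham.pow_const 2), ← lintegral_sub_right_eq_self g z]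
    refine lintegral_mono fun w => ?_
    simp only [ha, hg]
    rw [← ENNReal.ofReal_pow (by positivity), ← ENNReal.ofReal_mul (by positivity)]
    refine ENNReal.ofReal_le_ofReal ?_
    have h2 : ‖mpow w α‖ / polyWeight α z ≤ Real.exp (A * normOneC (w - z)) := by
      rw [div_le_iff₀' hP]; exact norm_mpow_le_polyWeight_mul_exp α z w
    calc (Real.pi ^ n)⁻¹ * Real.exp (-normSqC w) * (‖mpow w α‖ / polyWeight α z *
          Real.exp (1 / 2 * normSqC w - 1 / 4 * normSqC (z - w))) ^ 2
        ≤ (Real.pi ^ n)⁻¹ * Real.exp (-normSqC w) * (Real.exp (A * normOneC (w - z)) *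
          Real.exp (1 / 2 * normSqC w - 1 / 4 * normSqC (z - w))) ^ 2 := by gcongr
      _ = _ := by
        rw [← Real.exp_add, ← Real.exp_nat_mul, mul_assoc, ← Real.exp_add, normSqC_sub_comm z w]
        congr 2; push_cast; ring
  · refine lintegral_congr fun w => ?_
    simp only [hb, mul_pow]
    rw [← ENNReal.ofReal_pow (by positivity), ← Real.exp_nat_mul]
    congr 3; push_cast; ring

theorem BallBounded.exists_lintegral_gaussAverage_le {ν : Measure (Fin n → ℂ)} [SFinite ν]
    (h : BallBounded ν) : ∃ D : ℝ≥0, ∀ f : Fock n, ∫⁻ z, gaussAverage f z ∂ν ≤ D * ‖f‖ₑ ^ 2 := by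
  obtain ⟨D, hD⟩ := h.exists_lintegral_exp_le one_half_pos
  refine ⟨D, fun f => ?_⟩
  have hcont := continuous_normSqC (n := n)
  have h1 : Continuous fun p : (Fin n → ℂ) × (Fin n → ℂ) =>
      Real.exp (-(1 / 2) * normSqC (p.1 - p.2)) := by fun_prop
  have hm : Measurable (Function.uncurry fun z w : Fin n → ℂ =>
      ENNReal.ofReal (Real.exp (-(1 / 2) * normSqC (z - w))) * ‖f w‖ₑ ^ 2) :=
    h1.measurable.ennreal_ofReal.mul
      ((f.continuous.measurable.enorm.pow_const 2).comp measurable_snd)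
  calc ∫⁻ z, gaussAverage f z ∂ν
      = ∫⁻ w, ∫⁻ z, ENNReal.ofReal (Real.exp (-(1 / 2) * normSqC (z - w))) * ‖f w‖ₑ ^ 2 ∂ν
          ∂(gaussC n) := lintegral_lintegral_swap hm.aemeasurable
    _ ≤ ∫⁻ w, D * ‖f w‖ₑ ^ 2 ∂(gaussC n) := by
        refine lintegral_mono fun w => ?_
        rw [lintegral_mul_const' _ _ (by simp)]
        gcongr
        exact hD w
    _ = D * ‖f‖ₑ ^ 2 := by
        rw [lintegral_const_mul' _ _ ENNReal.coe_ne_top, f.lintegral_enorm_sq]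

theorem Fock.continuous_formIntegrand (α β : Fin n → ℕ) (f g : Fock n) :
    Continuous (formIntegrand α β f g) := by
  have h1 := f.continuous_mderiv α
  have h2 := g.continuous_mderiv β
  have h3 := continuous_normSqC (n := n)
  unfold formIntegrand
  fun_prop

/-- The coderivative form of order `(α, β)` is bounded, as an absolutely convergent integral, if
the mass of unit polydisks decays like `∏ⱼ (1 + |zⱼ|)^{-(αⱼ + βⱼ)}`. -/
theorem exists_lintegral_formIntegrand_le {α β : Fin n → ℕ} {μ : Measure (Fin n → ℂ)} [SFinite μ]
    (h : BallBounded (polyWeighted (α + β) μ)) : ∃ C : ℝ≥0, ∀ f g : Fock n,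
      ∫⁻ z, ‖formIntegrand α β f g z‖ₑ ∂μ ≤ C * (‖f‖ₑ * ‖g‖ₑ) := by
  obtain ⟨D, hD⟩ := h.exists_lintegral_gaussAverage_le
  obtain ⟨A, hA⟩ := exists_enorm_mderiv_sq_le α
  obtain ⟨B, hB⟩ := exists_enorm_mderiv_sq_le β
  refine ⟨(A * D) * (B * D) + 1, fun f g => ?_⟩
  have hmeas : ∀ (γ : Fin n → ℕ) (f : Fock n), Measurable fun z => ‖mderiv γ f z‖ₑ *
      ENNReal.ofReal (Real.exp (-(1 / 2) * normSqC z) / polyWeight γ z) := fun γ f => by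
    have h1 := continuous_normSqC (n := n)
    have h2 : Continuous fun z => Real.exp (-(1 / 2) * normSqC z) / polyWeight γ z :=
      Continuous.div (by fun_prop) (continuous_polyWeight γ) fun z => (polyWeight_pos γ z).ne'
    exact (f.continuous_mderiv γ).measurable.enorm.mul h2.measurable.ennreal_ofReal
  have hsplit : ∫⁻ z, ‖formIntegrand α β f g z‖ₑ ∂μ = ∫⁻ z,
      (‖mderiv α f z‖ₑ * ENNReal.ofReal (Real.exp (-(1 / 2) * normSqC z) / polyWeight α z)) *
      (‖mderiv β g z‖ₑ * ENNReal.ofReal (Real.exp (-(1 / 2) * normSqC z) / polyWeight β z))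
        ∂(polyWeighted (α + β) μ) := by
    refine Eq.trans ?_ (lintegral_withDensity_eq_lintegral_mul μ
      (measurable_ofReal_polyWeight (α + β)) ((hmeas α f).mul (hmeas β g))).symm
    refine lintegral_congr fun z => ?_
    have hα := polyWeight_pos α z
    have hβ := polyWeight_pos β z
    have hαβ := polyWeight_pos (α + β) z
    simp only [Pi.mul_apply, formIntegrand, ← ofReal_norm]
    rw [norm_mul, norm_mul, RCLike.norm_conj, Complex.norm_real, Real.norm_eq_abs, Real.abs_exp,
      ← ENNReal.ofReal_mul (by positivity), ← ENNReal.ofReal_mul (by positivity),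
      ← ENNReal.ofReal_mul (by positivity), ← ENNReal.ofReal_mul (by positivity)]
    congr 1
    have e : Real.exp (-normSqC z) =
        Real.exp (-(1 / 2) * normSqC z) * Real.exp (-(1 / 2) * normSqC z) := by
      rw [← Real.exp_add]; congr 1; ring
    rw [e, polyWeight_add]
    field_simp
  have hfac : ∀ (γ : Fin n → ℕ) (C : ℝ≥0) (f : Fock n), (∀ z, (‖mderiv γ f z‖ₑ *
      ENNReal.ofReal (Real.exp (-(1 / 2) * normSqC z) / polyWeight γ z)) ^ 2 ≤
        C * gaussAverage f z) →
      ∫⁻ z, (‖mderiv γ f z‖ₑ *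
        ENNReal.ofReal (Real.exp (-(1 / 2) * normSqC z) / polyWeight γ z)) ^ 2
          ∂(polyWeighted (α + β) μ) ≤ C * (D * ‖f‖ₑ ^ 2) := fun γ C f hC => by
    refine (lintegral_mono hC).trans ?_
    rw [lintegral_const_mul' _ _ ENNReal.coe_ne_top]
    gcongr
    exact hD f
  refine (ENNReal.pow_le_pow_left_iff two_ne_zero).1 ?_
  rw [hsplit]
  refine (sq_lintegral_mul_le (hmeas α f).aemeasurable (hmeas β g).aemeasurable).trans ?_
  refine (mul_le_mul' (hfac α A f (hA f)) (hfac β B g (hB g))).trans ?_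
  calc (A * (D * ‖f‖ₑ ^ 2) * (B * (D * ‖g‖ₑ ^ 2)) : ℝ≥0∞)
      = ((A * D * (B * D) : ℝ≥0) : ℝ≥0∞) * (‖f‖ₑ * ‖g‖ₑ) ^ 2 := by push_cast; ring
    _ ≤ ((A * D * (B * D) + 1 : ℝ≥0) : ℝ≥0∞) ^ 2 * (‖f‖ₑ * ‖g‖ₑ) ^ 2 := by
        gcongr
        rw [← ENNReal.coe_pow, ENNReal.coe_le_coe]
        nlinarith [zero_le (a := A * D * (B * D))]
    _ = _ := (mul_pow _ _ _).symm

theorem integrable_formIntegrand {α β : Fin n → ℕ} {μ : Measure (Fin n → ℂ)} [SFinite μ]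
    (h : BallBounded (polyWeighted (α + β) μ)) (f g : Fock n) :
    Integrable (formIntegrand α β f g) μ := by
  obtain ⟨C, hC⟩ := exists_lintegral_formIntegrand_le h
  refine ⟨(Fock.continuous_formIntegrand α β f g).aestronglyMeasurable, ?_⟩
  exact (hC f g).trans_lt (ENNReal.mul_lt_top ENNReal.coe_lt_top
    (ENNReal.mul_lt_top enorm_lt_top enorm_lt_top))

theorem exists_norm_coderivForm_le {α β : Fin n → ℕ} {μ : Measure (Fin n → ℂ)} [SFinite μ]
    (h : BallBounded (polyWeighted (α + β) μ)) : ∃ C : ℝ, ∀ f g : Fock n,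
      ‖coderivForm μ α β f g‖ ≤ C * (‖f‖ * ‖g‖) := by
  obtain ⟨C, hC⟩ := exists_lintegral_formIntegrand_le h
  refine ⟨(Real.pi ^ n)⁻¹ * C, fun f g => ?_⟩
  have h1 : ‖∫ z, formIntegrand α β f g z ∂μ‖ ≤ C * (‖f‖ * ‖g‖) := by
    have := (enorm_integral_le_lintegral_enorm _).trans (hC f g)
    simp only [enorm_eq_nnnorm] at this
    exact_mod_cast this
  rw [coderivForm, norm_mul, mul_assoc]
  refine mul_le_mul (le_of_eq ?_) h1 (norm_nonneg _) (by positivity)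
  rw [norm_inv, norm_pow, Complex.norm_real, Real.norm_eq_abs, abs_of_pos Real.pi_pos]

/-! ### The Toeplitz operator of a real coderivative -/

theorem formIntegrand_add_left (α β : Fin n → ℕ) (f f' g : Fock n) (z : Fin n → ℂ) :
    formIntegrand α β (f + f') g z = formIntegrand α β f g z + formIntegrand α β f' g z := by
  simp only [formIntegrand, Fock.mderiv_add]; ring

theorem formIntegrand_add_right (α β : Fin n → ℕ) (f g g' : Fock n) (z : Fin n → ℂ) :
    formIntegrand α β f (g + g') z = formIntegrand α β f g z + formIntegrand α β f g' z := by
  simp only [formIntegrand, Fock.mderiv_add, map_add]; ring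

theorem coderivForm_smul_left (μ : Measure (Fin n → ℂ)) (α β : Fin n → ℕ) (c : ℂ)
    (f g : Fock n) : coderivForm μ α β (c • f) g = c * coderivForm μ α β f g := by
  have h : ∀ z, formIntegrand α β (c • f) g z = c * formIntegrand α β f g z := fun z => by
    simp only [formIntegrand, Fock.mderiv_smul]; ring
  simp only [coderivForm, h, integral_const_mul]; ring

theorem coderivForm_smul_right (μ : Measure (Fin n → ℂ)) (α β : Fin n → ℕ) (c : ℂ)
    (f g : Fock n) : coderivForm μ α β f (c • g) = conj c * coderivForm μ α β f g := by
  have h : ∀ z, formIntegrand α β f (c • g) z = conj c * formIntegrand α β f g z := fun z => by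
    simp only [formIntegrand, Fock.mderiv_smul, map_mul]; ring
  simp only [coderivForm, h, integral_const_mul]; ring

theorem realCoderivForm_smul_left (μ : Measure (Fin n → ℂ)) (m : Fin n → ℕ) (c : ℂ)
    (f g : Fock n) : realCoderivForm μ m (c • f) g = c * realCoderivForm μ m f g := by
  simp only [realCoderivForm, coderivForm_smul_left, Finset.mul_sum]
  exact Finset.sum_congr rfl fun β _ => by ring

theorem realCoderivForm_smul_right (μ : Measure (Fin n → ℂ)) (m : Fin n → ℕ) (c : ℂ)
    (f g : Fock n) : realCoderivForm μ m f (c • g) = conj c * realCoderivForm μ m f g := by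
  simp only [realCoderivForm, coderivForm_smul_right, Finset.mul_sum]
  exact Finset.sum_congr rfl fun β _ => by ring

theorem realCoderivForm_add_left {μ : Measure (Fin n → ℂ)} [SFinite μ] {m : Fin n → ℕ}
    (h : BallBounded (polyWeighted m μ))
    (f f' g : Fock n) :
    realCoderivForm μ m (f + f') g = realCoderivForm μ m f g + realCoderivForm μ m f' g := by
  simp only [realCoderivForm, ← Finset.sum_add_distrib]
  refine Finset.sum_congr rfl fun β hβ => ?_
  have hm : m - β + β = m := tsub_add_cancel_of_le (Finset.mem_Iic.1 hβ)
  have h' : BallBounded (polyWeighted (m - β + β) μ) := by rwa [hm]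
  simp only [coderivForm, formIntegrand_add_left]
  rw [integral_add (integrable_formIntegrand h' f g) (integrable_formIntegrand h' f' g)]
  ring

theorem realCoderivForm_add_right {μ : Measure (Fin n → ℂ)} [SFinite μ] {m : Fin n → ℕ}
    (h : BallBounded (polyWeighted m μ))
    (f g g' : Fock n) :
    realCoderivForm μ m f (g + g') = realCoderivForm μ m f g + realCoderivForm μ m f g' := by
  simp only [realCoderivForm, ← Finset.sum_add_distrib]
  refine Finset.sum_congr rfl fun β hβ => ?_
  have hm : m - β + β = m := tsub_add_cancel_of_le (Finset.mem_Iic.1 hβ)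
  have h' : BallBounded (polyWeighted (m - β + β) μ) := by rwa [hm]
  simp only [coderivForm, formIntegrand_add_right]
  rw [integral_add (integrable_formIntegrand h' f g) (integrable_formIntegrand h' f g')]
  ring

theorem exists_norm_realCoderivForm_le {μ : Measure (Fin n → ℂ)} [SFinite μ] {m : Fin n → ℕ}
    (h : BallBounded (polyWeighted m μ)) : ∃ C : ℝ, ∀ f g : Fock n,
    ‖realCoderivForm μ m f g‖ ≤ C * (‖f‖ * ‖g‖) := by
  have h1 : ∀ β ∈ Finset.Iic m, ∃ C : ℝ, ∀ f g : Fock n,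
      ‖coderivForm μ (m - β) β f g‖ ≤ C * (‖f‖ * ‖g‖) := fun β hβ => by
    have hm : m - β + β = m := tsub_add_cancel_of_le (Finset.mem_Iic.1 hβ)
    exact exists_norm_coderivForm_le (by rwa [hm])
  choose! C hC using h1
  refine ⟨∑ β ∈ Finset.Iic m, mchoose m β * C β, fun f g => ?_⟩
  rw [realCoderivForm, Finset.sum_mul]
  refine (norm_sum_le _ _).trans (Finset.sum_le_sum fun β hβ => ?_)
  rw [norm_mul, Complex.norm_natCast, mul_assoc]
  exact mul_le_mul_of_nonneg_left (hC β hβ f g) (Nat.cast_nonneg _)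

/-- The bounded operator generated by the form of the real coderivative exists, by the Riesz
representation theorem in the (complete) Fock space, and is unique. -/
theorem existsUnique_isRealCoderivToeplitz {μ : Measure (Fin n → ℂ)} [SFinite μ] {m : Fin n → ℕ}
    (h : BallBounded (polyWeighted m μ)) :
    ∃! T : Fock n →L[ℂ] Fock n, IsRealCoderivToeplitz μ m T := by
  obtain ⟨C, hC⟩ := exists_norm_realCoderivForm_le h
  set B : Fock n →L⋆[ℂ] Fock n →L[ℂ] ℂ := LinearMap.mkContinuous₂
    (LinearMap.mk₂'ₛₗ (starRingEnd ℂ) (RingHom.id ℂ) (fun g f => realCoderivForm μ m f g)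
      (fun g g' f => realCoderivForm_add_right h f g g')
      (fun c g f => realCoderivForm_smul_right μ m c f g)
      (fun g f f' => realCoderivForm_add_left h f f' g)
      (fun c g f => realCoderivForm_smul_left μ m c f g)) C
    (fun g f => (hC f g).trans_eq (by ring))
  refine ⟨ContinuousLinearMap.adjoint (InnerProductSpace.continuousLinearMapOfBilin B),
    fun f g => ?_, fun T hT => ?_⟩
  · rw [ContinuousLinearMap.adjoint_inner_right,
      InnerProductSpace.continuousLinearMapOfBilin_apply]
    rfl
  · ext1 f
    refine ext_inner_left ℂ fun g => ?_
    rw [ContinuousLinearMap.adjoint_inner_right,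
      InnerProductSpace.continuousLinearMapOfBilin_apply]
    exact hT f g

/-- The multi-index binomial theorem. -/
theorem sum_mchoose_mul_mpow (m : Fin n → ℕ) (a b : Fin n → ℂ) :
    ∑ β ∈ Finset.Iic m, (mchoose m β : ℂ) * (mpow a (m - β) * mpow b β) = mpow (a + b) m := by
  have h1 : ∀ j, (a j + b j) ^ m j =
      ∑ i ∈ Finset.Iic (m j), ((m j).choose i : ℂ) * (a j ^ (m j - i) * b j ^ i) := fun j => by
    rw [add_comm, add_pow, ← Nat.range_succ_eq_Iic]
    exact Finset.sum_congr rfl fun i _ => by ring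
  simp only [mpow, Pi.add_apply, h1, mchoose]
  rw [Finset.prod_univ_sum]
  refine Finset.sum_congr ?_ fun β _ => ?_
  · ext β; simp [Pi.le_def]
  · push_cast
    simp only [Finset.prod_mul_distrib, Pi.sub_apply]

/-- On reproducing kernels the real coderivative of a kernel product is multiplication by
`(conj(a) + b)^m`. -/
theorem realCoderivForm_kernel (μ : Measure (Fin n → ℂ)) (m : Fin n → ℕ) (a b : Fin n → ℂ) :
    realCoderivForm μ m (kernel a) (kernel b) = mpow (conjC a + b) m *
      (((Real.pi : ℂ) ^ n)⁻¹ *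
        ∫ w, Complex.exp (dotC (conjC a) w + dotC b (conjC w) - normSqC w) ∂μ) := by
  have h1 : ∀ (α β : Fin n → ℕ) (w : Fin n → ℂ), formIntegrand α β (kernel a) (kernel b) w =
      (mpow (conjC a) α * mpow b β) *
        Complex.exp (dotC (conjC a) w + dotC b (conjC w) - normSqC w) := fun α β w => by
    have hb : conj (mpow (conjC b) β) = mpow b β := by simp [mpow, conjC]
    simp only [formIntegrand, mderiv_kernel, map_mul, hb, conj_kernel_apply]
    rw [kernel_apply, sub_eq_add_neg, Complex.exp_add, Complex.exp_add, Complex.ofReal_exp,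
      Complex.ofReal_neg]
    ring
  simp only [realCoderivForm, coderivForm, h1, integral_const_mul]
  rw [← sum_mchoose_mul_mpow, Finset.sum_mul]
  exact Finset.sum_congr rfl fun β _ => by ring

/-- The Gaussian transform `z ↦ ∫ exp(-|z - w|²) dμ(w)`. -/
def heatTransform (μ : Measure (Fin n → ℂ)) (z : Fin n → ℂ) : ℝ :=
  ∫ w, Real.exp (-normSqC (z - w)) ∂μ

theorem berezinRealCoderiv_eq (μ : Measure (Fin n → ℂ)) (m : Fin n → ℕ) (z : Fin n → ℂ) :
    berezinRealCoderiv μ m z =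
      mpow (conjC z + z) m * (((Real.pi : ℂ) ^ n)⁻¹ * heatTransform μ z) := by
  simp only [berezinRealCoderiv, berezinCoderiv, heatTransform]
  rw [← sum_mchoose_mul_mpow, Finset.sum_mul]
  exact Finset.sum_congr rfl fun β _ => by ring

theorem inner_kernel_self (z : Fin n → ℂ) :
    inner ℂ (kernel z) (kernel z) = Complex.exp (normSqC z) := by
  rw [inner_kernel_left, kernel_apply, ofReal_normSqC, dotC_comm]

theorem IsRealCoderivToeplitz.berezinOp_eq {μ : Measure (Fin n → ℂ)} {m : Fin n → ℕ}
    {T : Fock n →L[ℂ] Fock n} (hT : IsRealCoderivToeplitz μ m T) :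
    berezinOp T = berezinRealCoderiv μ m := by
  ext1 z
  rw [berezinOp, hT, realCoderivForm_kernel, berezinRealCoderiv_eq, inner_kernel_self,
    div_eq_iff (Complex.exp_ne_zero _), heatTransform, mul_assoc, mul_assoc]
  congr 2
  rw [← integral_complex_ofReal, ← integral_mul_const]
  congr 1; ext1 w
  rw [Complex.ofReal_exp, ← Complex.exp_add]
  congr 1
  push_cast
  simp only [ofReal_normSqC, conjC_sub, dotC_sub_left, dotC_sub_right]
  rw [dotC_comm (conjC z)]
  ring

/-! ### Horizontal operators and invariance in imaginary directions -/

theorem conjC_imagVec (h : Fin n → ℝ) : conjC (imagVec h) = -imagVec h := by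
  ext j; simp [conjC, imagVec]

theorem eq_add_imagVec (z : Fin n → ℂ) :
    z = (fun j => ((z j).re : ℂ)) + imagVec fun j => (z j).im := by
  ext j; simp [imagVec, mul_comm I]

theorem dependsOnlyOnRe_iff {φ : (Fin n → ℂ) → ℂ} :
    DependsOnlyOnRe φ ↔ ∀ z h, φ (z + imagVec h) = φ z := by
  refine ⟨fun ⟨b, hb⟩ z h => ?_, fun H => ⟨fun x => φ fun j => (x j : ℂ), fun z => ?_⟩⟩
  · rw [hb, hb]; congr 1; ext j; simp [reC, imagVec]
  · conv_lhs => rw [eq_add_imagVec z]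
    exact H _ _

/-- Conjugation by the isometries `W_{ih}` shifts the Berezin transform by `ih`. -/
theorem IsHorizontalOp.dependsOnlyOnRe_berezinOp {T : Fock n →L[ℂ] Fock n}
    (hT : IsHorizontalOp T) : DependsOnlyOnRe (berezinOp T) := by
  refine dependsOnlyOnRe_iff.2 fun z h => ?_
  have h1 := inner_weyl (imagVec h) (kernel z) (T (kernel z))
  have h2 := inner_weyl (imagVec h) (kernel z) (kernel z)
  rw [hT h (kernel z)] at h1
  rw [weyl_kernel] at h1 h2
  set c := Complex.exp (-dotC (conjC z) (imagVec h) - (normSqC (imagVec h) / 2 : ℝ))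
  have hc0 : c ≠ 0 := Complex.exp_ne_zero _
  have hc1 : conj c ≠ 0 := by simpa using hc0
  rw [map_smul] at h1
  simp only [inner_smul_left, inner_smul_right] at h1 h2
  rw [berezinOp, berezinOp, ← h1, ← h2, mul_div_mul_left _ _ hc0, mul_div_mul_left _ _ hc1]

/-- The measure is invariant under the translations by `ih`, `h ∈ ℝⁿ`. -/
def ImagInvariant (μ : Measure (Fin n → ℂ)) : Prop :=
  ∀ h : Fin n → ℝ, μ.map (fun z => z + imagVec h) = μ

theorem ImagInvariant.integral_eq {μ : Measure (Fin n → ℂ)} (hμ : ImagInvariant μ)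
    (h : Fin n → ℝ) (f : (Fin n → ℂ) → ℂ) : ∫ w, f w ∂μ = ∫ w, f (w + imagVec h) ∂μ := by
  conv_lhs => rw [← hμ h]
  exact (Homeomorph.addRight (imagVec h)).measurableEmbedding.integral_map f

theorem ImagInvariant.realCoderivForm_weyl_kernel {μ : Measure (Fin n → ℂ)}
    (hμ : ImagInvariant μ) (m : Fin n → ℕ) (h : Fin n → ℝ) (a b : Fin n → ℂ) :
    realCoderivForm μ m (weyl (imagVec h) (kernel a)) (weyl (imagVec h) (kernel b)) =
      realCoderivForm μ m (kernel a) (kernel b) := by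
  rw [weyl_kernel, weyl_kernel, realCoderivForm_smul_left, realCoderivForm_smul_right,
    realCoderivForm_kernel, realCoderivForm_kernel, hμ.integral_eq h]
  have e : conjC (a + imagVec h) + (b + imagVec h) = conjC a + b := by
    rw [conjC_add, conjC_imagVec]; abel
  rw [e, ← mul_assoc, mul_left_comm, mul_left_comm _ (((Real.pi : ℂ) ^ n)⁻¹),
    ← integral_const_mul]
  congr 3; ext1 w
  rw [← Complex.exp_conj, ← Complex.exp_add, ← Complex.exp_add]
  congr 1
  simp only [map_sub, map_neg, conj_dotC, conjC_conjC, Complex.conj_ofReal]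
  push_cast
  simp only [ofReal_normSqC, conjC_add, dotC_add_left, dotC_add_right, conjC_imagVec,
    dotC_neg_left, dotC_neg_right]
  rw [dotC_comm (imagVec h) w]
  ring

/-- An invariant measure has a horizontal Toeplitz operator: the intertwining relation holds
between kernels, since `W_{ih}` permutes them up to scalars. -/
theorem IsRealCoderivToeplitz.isHorizontalOp {μ : Measure (Fin n → ℂ)} {m : Fin n → ℕ}
    {T : Fock n →L[ℂ] Fock n} (hT : IsRealCoderivToeplitz μ m T) (hμ : ImagInvariant μ) :
    IsHorizontalOp T := by
  intro h f
  set W : Fock n →L[ℂ] Fock n := (weylIsometry (imagVec h)).toContinuousLinearMap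
  have hWT : W.comp T = T.comp W := by
    refine Fock.clm_ext_kernel fun a => Fock.ext fun b => ?_
    change weyl (imagVec h) (T (kernel a)) b = T (weyl (imagVec h) (kernel a)) b
    have hk := weyl_kernel (imagVec h) (b - imagVec h)
    rw [sub_add_cancel] at hk
    set c := Complex.exp (-dotC (conjC (b - imagVec h)) (imagVec h) -
      (normSqC (imagVec h) / 2 : ℝ))
    have hc0 : conj c ≠ 0 := (map_ne_zero _).2 (Complex.exp_ne_zero _)
    refine mul_left_cancel₀ hc0 ?_
    rw [← inner_kernel_left b, ← inner_kernel_left b, ← inner_smul_left, ← inner_smul_left, ← hk,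
      inner_weyl, hT, hT, hμ.realCoderivForm_weyl_kernel]
  exact DFunLike.congr_fun hWT f

/-! ### Measures are determined by their Gaussian transforms -/

theorem BallBounded.integrable_exp_neg_normSqC_sub {μ : Measure (Fin n → ℂ)} [SFinite μ]
    (h : BallBounded μ) (z : Fin n → ℂ) :
    Integrable (fun w => Real.exp (-normSqC (z - w))) μ := by
  have := h.integrable_exp one_pos z
  simp only [neg_one_mul] at this
  simpa only [normSqC_sub_comm z] using this

theorem BallBounded.continuous_heatTransform {μ : Measure (Fin n → ℂ)} [SFinite μ]
    (h : BallBounded μ) : Continuous (heatTransform μ) := by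
  refine continuous_iff_continuousAt.2 fun z₀ => ?_
  have hcont := continuous_normSqC (n := n)
  refine continuousAt_of_dominated
    (bound := fun w => Real.exp n * Real.exp (-(1 / 2) * normSqC (w - z₀)))
    (Filter.Eventually.of_forall fun z => (h.integrable_exp_neg_normSqC_sub z).aestronglyMeasurable)
    ?_ ((h.integrable_exp one_half_pos z₀).const_mul _)
    (Filter.Eventually.of_forall fun w => Continuous.continuousAt (by fun_prop))
  filter_upwards [Metric.ball_mem_nhds z₀ one_pos] with z hz
  refine Filter.Eventually.of_forall fun w => ?_
  rw [Real.norm_eq_abs, Real.abs_exp, ← Real.exp_add, Real.exp_le_exp]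
  have h1 : normSqC (w - z₀) ≤ 2 * normSqC (w - z) + 2 * normSqC (z - z₀) := by
    rw [← sub_add_sub_cancel w z z₀]; exact normSqC_add_le _ _
  have h2 : normSqC (z - z₀) ≤ n * 1 ^ 2 := normSqC_le fun j =>
    (norm_le_pi_norm (z - z₀) j).trans (mem_ball_iff_norm.1 hz).le
  rw [normSqC_sub_comm z w]
  linarith

/-- The finite measure with density `exp(-|w|²)` with respect to `μ`. -/
def gaussWeighted (μ : Measure (Fin n → ℂ)) : Measure (Fin n → ℂ) :=
  μ.withDensity fun w => ENNReal.ofReal (Real.exp (-normSqC w))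

theorem measurable_ofReal_exp_neg_normSqC :
    Measurable fun w : Fin n → ℂ => ENNReal.ofReal (Real.exp (-normSqC w)) := by
  have hcont := continuous_normSqC (n := n)
  exact (Continuous.measurable (by fun_prop)).ennreal_ofReal

theorem gaussWeighted_injective {μ ν : Measure (Fin n → ℂ)}
    (h : gaussWeighted μ = gaussWeighted ν) : μ = ν := by
  have key : ∀ μ : Measure (Fin n → ℂ), (gaussWeighted μ).withDensity
      (fun w => (ENNReal.ofReal (Real.exp (-normSqC w)))⁻¹) = μ := fun μ =>
    withDensity_inv_same measurable_ofReal_exp_neg_normSqC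
      (Filter.Eventually.of_forall fun w => by simp [Real.exp_pos])
      (Filter.Eventually.of_forall fun w => ENNReal.ofReal_ne_top)
  rw [← key μ, h, key ν]

theorem exists_eq_two_mul_re_dotC (L : StrongDual ℝ (Fin n → ℂ)) :
    ∃ a : Fin n → ℂ, ∀ w, L w = 2 * (dotC w (conjC a)).re := by
  refine ⟨fun j => ⟨L (Pi.single j 1) / 2, L (Pi.single j I) / 2⟩, fun w => ?_⟩
  have hw : ∀ j, L (Pi.single j (w j)) =
      (w j).re * L (Pi.single j 1) + (w j).im * L (Pi.single j I) := fun j => by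
    rw [← smul_eq_mul, ← smul_eq_mul, ← map_smul, ← map_smul, ← map_add, ← Pi.single_smul,
      ← Pi.single_smul, ← Pi.single_add]
    congr 2
    simp
  conv_lhs => rw [← Finset.univ_sum_single w]
  rw [map_sum, dotC, Complex.re_sum, Finset.mul_sum]
  refine Finset.sum_congr rfl fun j _ => ?_
  rw [hw]
  simp [conjC]
  ring

/-- The exponential moments of `exp(-|w|²) dμ` are values of the Gaussian transform of `μ`. -/
theorem integrable_and_integral_exp_gaussWeighted {μ : Measure (Fin n → ℂ)}
    (hμ : ∀ z, Integrable (fun w => Real.exp (-normSqC (z - w))) μ) (a : Fin n → ℂ) :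
    Integrable (fun w => Real.exp (2 * (dotC w (conjC a)).re)) (gaussWeighted μ) ∧
      ∫ w, Real.exp (2 * (dotC w (conjC a)).re) ∂(gaussWeighted μ) =
        Real.exp (normSqC a) * heatTransform μ a := by
  have h1 : ∀ w, (ENNReal.ofReal (Real.exp (-normSqC w))).toReal •
      Real.exp (2 * (dotC w (conjC a)).re) =
        Real.exp (normSqC a) * Real.exp (-normSqC (a - w)) := fun w => by
    rw [ENNReal.toReal_ofReal (by positivity), smul_eq_mul, ← Real.exp_add, ← Real.exp_add,
      normSqC_sub_comm a w, normSqC_sub]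
    congr 1; ring
  have ht : ∀ᵐ w ∂μ, ENNReal.ofReal (Real.exp (-normSqC w)) < ∞ :=
    Filter.Eventually.of_forall fun w => ENNReal.ofReal_lt_top
  constructor
  · rw [gaussWeighted, integrable_withDensity_iff_integrable_smul'
      measurable_ofReal_exp_neg_normSqC ht]
    simp only [h1]
    exact (hμ a).const_mul _
  · rw [gaussWeighted, integral_withDensity_eq_integral_toReal_smul
      measurable_ofReal_exp_neg_normSqC ht]
    simp only [h1, integral_const_mul, heatTransform]

/-- A measure is determined by its Gaussian transform: up to the factor `exp(|z|²)` this is the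
Laplace transform of the finite measure `exp(-|w|²) dμ`, whose analytic continuation gives the
characteristic function. -/
theorem eq_of_heatTransform_eq {μ ν : Measure (Fin n → ℂ)}
    (hμ : ∀ z, Integrable (fun w => Real.exp (-normSqC (z - w))) μ)
    (hν : ∀ z, Integrable (fun w => Real.exp (-normSqC (z - w))) ν)
    (h : heatTransform μ = heatTransform ν) : μ = ν := by
  have hfin : ∀ μ : Measure (Fin n → ℂ),
      (∀ z, Integrable (fun w => Real.exp (-normSqC (z - w))) μ) →
      IsFiniteMeasure (gaussWeighted μ) := fun μ hμ => by
    have := (integrable_and_integral_exp_gaussWeighted hμ 0).1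
    simpa [conjC, dotC, integrable_const_iff, isFiniteMeasure_iff] using this
  have := hfin μ hμ
  have := hfin ν hν
  have hexp : ∀ (L : StrongDual ℝ (Fin n → ℂ)) (t : ℝ), ∃ a,
      ∀ w, Real.exp (t * L w) = Real.exp (2 * (dotC w (conjC a)).re) := fun L t => by
    obtain ⟨a, ha⟩ := exists_eq_two_mul_re_dotC (t • L)
    exact ⟨a, fun w => by rw [← ha]; rfl⟩
  refine gaussWeighted_injective (Measure.ext_of_charFunDual (funext fun L => ?_))
  have hm : ProbabilityTheory.mgf L (gaussWeighted μ) =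
      ProbabilityTheory.mgf L (gaussWeighted ν) := by
    ext t
    obtain ⟨a, ha⟩ := hexp L t
    simp only [ProbabilityTheory.mgf, ha]
    rw [(integrable_and_integral_exp_gaussWeighted hμ a).2,
      (integrable_and_integral_exp_gaussWeighted hν a).2, h]
  have hset : ProbabilityTheory.integrableExpSet L (gaussWeighted μ) = Set.univ := by
    refine Set.eq_univ_of_forall fun t => ?_
    obtain ⟨a, ha⟩ := hexp L t
    change Integrable (fun w => Real.exp (t * L w)) _
    simp only [ha]
    exact (integrable_and_integral_exp_gaussWeighted hμ a).1
  have hzero : gaussWeighted μ = 0 ↔ gaussWeighted ν = 0 := by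
    have h0 := congrFun hm 0
    simp only [ProbabilityTheory.mgf_zero'] at h0
    rw [← Measure.measure_univ_eq_zero, ← Measure.measure_univ_eq_zero, ← measureReal_eq_zero_iff,
      ← measureReal_eq_zero_iff, h0]
  have := ProbabilityTheory.eqOn_complexMGF_of_mgf' hm hzero (x := I) (by simp [hset])
  simpa only [ProbabilityTheory.complexMGF, charFunDual_apply, mul_comm I] using this

/-! ### From the Berezin transform to invariance -/

theorem heatTransform_map_add (μ : Measure (Fin n → ℂ)) (v z : Fin n → ℂ) :
    heatTransform (μ.map fun w => w + v) z = heatTransform μ (z - v) := by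
  refine ((Homeomorph.addRight v).measurableEmbedding.integral_map
    fun w => Real.exp (-normSqC (z - w))).trans ?_
  rw [heatTransform]
  congr 1; ext1 w
  rw [Homeomorph.coe_addRight, sub_add_eq_sub_sub_swap]

theorem integrable_exp_map_add {μ : Measure (Fin n → ℂ)}
    (hμ : ∀ z, Integrable (fun w => Real.exp (-normSqC (z - w))) μ) (v z : Fin n → ℂ) :
    Integrable (fun w => Real.exp (-normSqC (z - w))) (μ.map fun w => w + v) := by
  refine ((Homeomorph.addRight v).measurableEmbedding.integrable_map_iff
    (g := fun w => Real.exp (-normSqC (z - w)))).2 ((hμ (z - v)).congr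
      (Filter.Eventually.of_forall fun w => ?_))
  simp only [Function.comp, Homeomorph.coe_addRight]
  rw [sub_add_eq_sub_sub_swap]

/-- If the Berezin transform `(2 Re z)^m` times the Gaussian transform depends only on `Re z`, then
so does the Gaussian transform, first where no coordinate of `Re z` vanishes and then everywhere by
continuity. Hence `μ` and its translates have the same Gaussian transform. -/
theorem imagInvariant_of_dependsOnlyOnRe {μ : Measure (Fin n → ℂ)} [SFinite μ]
    (hb : BallBounded μ) {m : Fin n → ℕ} (h : DependsOnlyOnRe (berezinRealCoderiv μ m)) :
    ImagInvariant μ := by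
  rw [dependsOnlyOnRe_iff] at h
  have h1 : ∀ (z : Fin n → ℂ) (v : Fin n → ℝ), (∀ j, (z j).re ≠ 0) →
      heatTransform μ (z + imagVec v) = heatTransform μ z := fun z v hz => by
    have hzv := h z v
    have e : conjC (z + imagVec v) + (z + imagVec v) = conjC z + z := by
      rw [conjC_add, conjC_imagVec]; abel
    rw [berezinRealCoderiv_eq, berezinRealCoderiv_eq, e] at hzv
    have h0 : mpow (conjC z + z) m ≠ 0 := by
      refine Finset.prod_ne_zero_iff.2 fun j _ => pow_ne_zero _ fun h0 => hz j ?_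
      have := congrArg Complex.re h0
      simp only [Pi.add_apply, conjC, Complex.add_re, Complex.conj_re, Complex.zero_re] at this
      linarith
    have hpi : ((Real.pi : ℂ) ^ n)⁻¹ ≠ 0 := by simp [Real.pi_ne_zero]
    exact_mod_cast mul_left_cancel₀ hpi (mul_left_cancel₀ h0 hzv)
  have hc := hb.continuous_heatTransform
  have h2 : ∀ (z : Fin n → ℂ) (v : Fin n → ℝ),
      heatTransform μ (z + imagVec v) = heatTransform μ z := fun z v => by
    have hdense : Dense (Set.range fun j => -(z j).re)ᶜ :=
      (Set.finite_range _).countable.dense_compl ℝ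
    have key := Continuous.ext_on hdense
      (f := fun t : ℝ => heatTransform μ ((fun j => z j + t) + imagVec v))
      (g := fun t : ℝ => heatTransform μ (fun j => z j + t))
      (hc.comp (by fun_prop)) (hc.comp (by fun_prop)) fun t ht => by
        refine h1 _ v fun j hj => ht ⟨j, ?_⟩
        simp only [Complex.add_re, Complex.ofReal_re] at hj
        simp only
        linarith
    simpa using congrFun key 0
  intro v
  refine eq_of_heatTransform_eq (integrable_exp_map_add hb.integrable_exp_neg_normSqC_sub _)
    hb.integrable_exp_neg_normSqC_sub (funext fun z => ?_)
  rw [heatTransform_map_add, ← h2 (z - imagVec v) v, sub_add_cancel]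

/-! ### Invariance and product structure -/

/-- `(x, y) ↦ x + iy` as a homeomorphism. -/
def ofReImHomeomorph (n : ℕ) : (Fin n → ℝ) × (Fin n → ℝ) ≃ₜ (Fin n → ℂ) where
  toFun := ofReIm
  invFun z := (fun j => (z j).re, fun j => (z j).im)
  left_inv p := by ext j <;> simp [ofReIm]
  right_inv z := by ext j; simp [ofReIm, mul_comm I]
  continuous_toFun := by unfold ofReIm; fun_prop
  continuous_invFun := by fun_prop

theorem ofReIm_add (x y h : Fin n → ℝ) : ofReIm (x, y + h) = ofReIm (x, y) + imagVec h := by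
  ext j; simp [ofReIm, imagVec, mul_add, add_assoc]

theorem imagInvariant_iff {μ : Measure (Fin n → ℂ)} :
    ImagInvariant μ ↔ ∀ X : Set (Fin n → ℂ), MeasurableSet X → ∀ h : Fin n → ℝ,
      μ ((fun z => z + imagVec h) '' X) = μ X := by
  have hneg : ∀ h : Fin n → ℝ, imagVec (-h) = -imagVec h := fun h => by ext j; simp [imagVec]
  constructor
  · intro H X hX h
    conv_rhs => rw [← H (-h)]
    rw [Set.image_add_right, Measure.map_apply (by fun_prop) hX, hneg]
  · intro H h
    ext X hX
    rw [Measure.map_apply (by fun_prop) hX, ← H X hX (-h), Set.image_add_right, hneg, neg_neg]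

theorem image_ofReIm_prod_add (Y Z : Set (Fin n → ℝ)) (h : Fin n → ℝ) :
    ofReIm '' (Y ×ˢ ((fun y => y + h) '' Z)) =
      (fun z => z + imagVec h) '' (ofReIm '' (Y ×ˢ Z)) := by
  rw [Set.image_image]
  ext z
  constructor
  · rintro ⟨⟨x, _⟩, ⟨hx, y, hy, rfl⟩, rfl⟩
    exact ⟨(x, y), ⟨hx, hy⟩, (ofReIm_add x y h).symm⟩
  · rintro ⟨⟨x, y⟩, ⟨hx, hy⟩, rfl⟩
    exact ⟨(x, y + h), ⟨hx, y, hy, rfl⟩, ofReIm_add x y h⟩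

theorem IsHorizontalMeasure.imagInvariant {μ : Measure (Fin n → ℂ)} (h : IsHorizontalMeasure μ) :
    ImagInvariant μ := by
  obtain ⟨ϱ, hϱ, rfl⟩ := h
  intro h
  have hm : Measurable (ofReIm (n := n)) := (ofReImHomeomorph n).measurable
  have hmp : MeasurePreserving (Prod.map id fun y : Fin n → ℝ => y + h)
      (ϱ.prod volume) (ϱ.prod volume) :=
    (MeasurePreserving.id ϱ).prod (measurePreserving_add_right volume h)
  rw [Measure.map_map (by fun_prop) hm]
  conv_rhs => rw [← hmp.map_eq, Measure.map_map hm hmp.measurable]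
  congr 1
  ext1 p
  exact (ofReIm_add p.1 p.2 h).symm

/-- A locally finite measure on `ℝⁿ × ℝⁿ` that is invariant under translations in the second factor
on measurable rectangles is a product with Lebesgue measure: over a bounded base the slices are
translation invariant and locally finite, hence multiples of Lebesgue measure, and the unit cube
normalizes the multiple. -/
theorem exists_eq_prod_volume {μ : Measure ((Fin n → ℝ) × (Fin n → ℝ))}
    [IsFiniteMeasureOnCompacts μ]
    (h : ∀ Y Z : Set (Fin n → ℝ), MeasurableSet Y → MeasurableSet Z → ∀ v : Fin n → ℝ,
      μ (Y ×ˢ ((fun y => y + v) '' Z)) = μ (Y ×ˢ Z)) :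
    ∃ ϱ : Measure (Fin n → ℝ), ϱ.Regular ∧ μ = ϱ.prod volume := by
  set Q : Set (Fin n → ℝ) := Set.pi Set.univ fun _ => Set.Ico 0 1 with hQ
  have hQm : MeasurableSet Q := MeasurableSet.univ_pi fun _ => measurableSet_Ico
  have hQv : volume Q = 1 := by rw [hQ, Real.volume_pi_Ico]; simp
  have hQc : Q ⊆ Set.Icc 0 1 := fun x hx =>
    ⟨fun j => (hx j trivial).1, fun j => (hx j trivial).2.le⟩
  set ϱ : Measure (Fin n → ℝ) := (μ.restrict (Set.univ ×ˢ Q)).map Prod.fst with hϱ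
  have hϱa : ∀ Y, MeasurableSet Y → ϱ Y = μ (Y ×ˢ Q) := fun Y hY => by
    rw [hϱ, Measure.map_apply measurable_fst hY, Measure.restrict_apply (measurable_fst hY)]
    congr 1; ext p; simp
  have hϱc : IsFiniteMeasureOnCompacts ϱ := ⟨fun K hK => by
    rw [hϱa K hK.measurableSet]
    exact (measure_mono (Set.prod_mono le_rfl hQc)).trans_lt
      (hK.prod isCompact_Icc).measure_lt_top⟩
  have hϱl : IsLocallyFiniteMeasure ϱ := isLocallyFiniteMeasure_of_isFiniteMeasureOnCompacts
  have hbdd : ∀ K Y Z : Set (Fin n → ℝ), IsCompact K → Y ⊆ K → MeasurableSet Y → MeasurableSet Z →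
      μ (Y ×ˢ Z) = ϱ Y * volume Z := fun K Y Z hK hYK hY hZ => by
    set κ : Measure (Fin n → ℝ) := (μ.restrict (Y ×ˢ Set.univ)).map Prod.snd with hκ
    have hκa : ∀ Z, MeasurableSet Z → κ Z = μ (Y ×ˢ Z) := fun Z hZ => by
      rw [hκ, Measure.map_apply measurable_snd hZ, Measure.restrict_apply (measurable_snd hZ)]
      congr 1; ext p; simp [and_comm]
    have hκc : IsFiniteMeasureOnCompacts κ := ⟨fun L hL => by
      rw [hκa L hL.measurableSet]
      exact (measure_mono (Set.prod_mono hYK le_rfl)).trans_lt (hK.prod hL).measure_lt_top⟩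
    have hκl : IsLocallyFiniteMeasure κ := isLocallyFiniteMeasure_of_isFiniteMeasureOnCompacts
    have hκi : κ.IsAddLeftInvariant := ⟨fun v => by
      ext Z hZ
      have e : (fun y => v + y) ⁻¹' Z = (fun y => y + -v) '' Z := by
        rw [Set.image_add_right, neg_neg]; ext y; simp [add_comm]
      rw [Measure.map_apply (by fun_prop) hZ, hκa _ (measurable_const_add v hZ), e,
        h Y Z hY hZ, hκa Z hZ]⟩
    have hsmul := Measure.isAddLeftInvariant_eq_smul_of_regular κ volume
    set c := κ.addHaarScalarFactor volume
    have h1 : ϱ Y = c := by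
      rw [hϱa Y hY, ← hκa Q hQm, hsmul, Measure.smul_apply, hQv]; simp
    rw [← hκa Z hZ, h1, hsmul]
    rfl
  refine ⟨ϱ, inferInstance, (Measure.prod_eq fun Y Z hY hZ => ?_).symm⟩
  have hmono : Monotone fun N : ℕ => Y ∩ Metric.closedBall 0 N := fun N M hNM =>
    Set.inter_subset_inter_right _ (Metric.closedBall_subset_closedBall (by exact_mod_cast hNM))
  have hU : ⋃ N : ℕ, Y ∩ Metric.closedBall 0 (N : ℝ) = Y := by
    rw [← Set.inter_iUnion, Metric.iUnion_closedBall_nat, Set.inter_univ]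
  have h1 : μ (Y ×ˢ Z) = ⨆ N : ℕ, μ ((Y ∩ Metric.closedBall 0 (N : ℝ)) ×ˢ Z) := by
    conv_lhs => rw [← hU, Set.iUnion_prod_const]
    exact Monotone.measure_iUnion fun N M hNM => Set.prod_mono (hmono hNM) le_rfl
  have h2 : ϱ Y = ⨆ N : ℕ, ϱ (Y ∩ Metric.closedBall 0 (N : ℝ)) := by
    conv_lhs => rw [← hU]
    exact hmono.measure_iUnion
  rw [h1, h2, ENNReal.iSup_mul]
  exact iSup_congr fun N => hbdd _ _ Z (isCompact_closedBall 0 (N : ℝ)) Set.inter_subset_right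
    (hY.inter measurableSet_closedBall) hZ

theorem isHorizontalMeasure_of_image_eq {μ : Measure (Fin n → ℂ)} [μ.Regular]
    (h : ∀ Y Z : Set (Fin n → ℝ), MeasurableSet Y → MeasurableSet Z → ∀ v : Fin n → ℝ,
      μ (ofReIm '' (Y ×ˢ ((fun y => y + v) '' Z))) = μ (ofReIm '' (Y ×ˢ Z))) :
    IsHorizontalMeasure μ := by
  set e := ofReImHomeomorph n
  have ha : ∀ S, μ.map e.symm S = μ (ofReIm '' S) := fun S => by
    refine (e.symm.toMeasurableEquiv.map_apply S).trans ?_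
    exact congrArg μ (e.image_eq_preimage_symm S).symm
  have : (μ.map e.symm).Regular := Measure.Regular.map e.symm
  obtain ⟨ϱ, hϱ, hprod⟩ := exists_eq_prod_volume (μ := μ.map e.symm) fun Y Z hY hZ v => by
    rw [ha, ha, h Y Z hY hZ v]
  refine ⟨ϱ, hϱ, ?_⟩
  rw [← hprod]
  change μ = (μ.map e.symm).map e
  rw [Measure.map_map e.measurable e.symm.measurable, e.self_comp_symm, Measure.map_id]

end FockToeplitz

end

theorem theorem5p1 (n : ℕ) (k : Fin n → ℝ) (m : Fin n → ℕ) (hk : ∀ j, k j = (m j : ℝ) / 2)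
    (μ : Measure (Fin n → ℂ)) (hreg : μ.Regular) (hμ : IsKFC k μ) :
    (∀ α β : Fin n → ℕ, α + β = m → ∀ f g : Fock n, Integrable (formIntegrand α β f g) μ) ∧
    (∀ z : Fin n → ℂ, Integrable (fun w => Real.exp (-normSqC (z - w))) μ) ∧
    (∃! T : Fock n →L[ℂ] Fock n, IsRealCoderivToeplitz μ m T) ∧
    ∀ T : Fock n →L[ℂ] Fock n, IsRealCoderivToeplitz μ m T →
      berezinOp T = berezinRealCoderiv μ m ∧
      List.TFAE [
        IsHorizontalOp T,
        DependsOnlyOnRe (berezinRealCoderiv μ m),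
        ∀ X : Set (Fin n → ℂ), MeasurableSet X → ∀ h : Fin n → ℝ,
          μ ((fun z => z + imagVec h) '' X) = μ X,
        ∀ Y Z : Set (Fin n → ℝ), MeasurableSet Y → MeasurableSet Z → ∀ h : Fin n → ℝ,
          μ (ofReIm '' (Y ×ˢ ((fun y => y + h) '' Z))) = μ (ofReIm '' (Y ×ˢ Z)),
        IsHorizontalMeasure μ] := by
  have hb := hμ.ballBounded hk
  have hb' : BallBounded μ := hb.mono (le_polyWeighted m μ)
  refine ⟨fun α β hαβ f g => integrable_formIntegrand (by rwa [hαβ]) f g,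
    hb'.integrable_exp_neg_normSqC_sub, existsUnique_isRealCoderivToeplitz hb, fun T hT =>
    ⟨hT.berezinOp_eq, ?_⟩⟩
  tfae_have 1 → 2 := fun h => hT.berezinOp_eq ▸ h.dependsOnlyOnRe_berezinOp
  tfae_have 2 → 3 := fun h => imagInvariant_iff.1 (imagInvariant_of_dependsOnlyOnRe hb' h)
  tfae_have 3 → 4 := fun h Y Z hY hZ v => by
    rw [image_ofReIm_prod_add]
    exact h _ ((ofReImHomeomorph n).measurableEmbedding.measurableSet_image.2 (hY.prod hZ)) v
  tfae_have 4 → 5 := isHorizontalMeasure_of_image_eq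
  tfae_have 5 → 3 := fun h => imagInvariant_iff.1 h.imagInvariant
  tfae_have 3 → 1 := fun h => hT.isHorizontalOp (imagInvariant_iff.2 h)
  tfae_finish
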